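/- Let $n\ge 1$, let $f_1,\dots,f_n:\mathbb R^d\to\mathbb R$ be differentiable, and let $f=\frac1n\sum_{i=1}^n f_i$ have a minimizer $x^\star$. Let $L>0$, $\sigma\ge 0$, $\mu\ge 0$ be such that for all $x,y\in\mathbb R^d$ $$\frac1n\sum_i\|\nabla f_i(x)-\nabla f_i(y)\|^2\le L^2\|x-y\|^2,\qquad \frac1n\sum_i\|\nabla f_i(x)-\nabla f(x)\|^2\le\sigma^2,\qquad \|\nabla f(x)\|^2\ge 2\mu\,(f(x)-f(x^\star)).$$ **Algorithm (Q-Geom-SARAH).** Let $m_j=B_j=j^2\wedge n$, let $b_j\ge 1$ be any integers with $b_j\le\sqrt{m_j}$, and let $\eta_j=b_j/(2L\sqrt{m_j})$, for $j=1,2,\dots$. Given $\tilde x_0$ and an integer $T\ge1$, run the epochs $j=1,\dots,2T$. Epoch $j$ starts from $x_0=\tilde x_{j-1}$, draws a uniformly random set $J\subset\{1,\dots,n\}$ of size $B_j$, sets $v_0=\frac1{B_j}\sum_{i\in J}\nabla f_i(x_0)$, and draws $N_j$ geometric on $\{0,1,2,\dots\}$ with mean $m_j/b_j$. For $k=0,\dots,N_j-1$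 it sets $x_{k+1}=x_k-\eta_jv_k$, draws a fresh uniformly random set $I$ of size $b_j$, and sets $v_{k+1}=v_k+\frac1{b_j}\sum_{i\in I}(\nabla f_i(x_{k+1})-\nabla f_i(x_k))$. Then $\tilde x_j=x_{N_j}$. The output is $\tilde x_{R(T)}$, where $R(T)$ is independent of the epochs, takes values in $\{T,\dots,2T\}$, and has $\mathbb P(R(T)=j)\propto\eta_jm_j/b_j$. Each evaluation of some $(f_i(x),\nabla f_i(x))$ costs one query, so epoch $j$ costs $B_j+2b_jN_j$ queries. **Complexity.** For $\varepsilon>0$ let $T_g(\varepsilon)$ be the least $T\ge1$ such that $\mathbb E\|\nabla f(\tilde x_{R(T')})\|^2\le\varepsilon^2$ for all $T'\ge T$, and let $T_f(\varepsilon)$ be the least $T\ge 1$ such that $\mathbb E(f(\tilde x_{R(T')})-f(x^\star))\le\varepsilon^2$ for all $T'\ge T$. Let $\mathbb E\,\mathrm{Comp}_g(\varepsilon)$ and $\mathbb E\,\mathrm{Comp}_f(\varepsilon)$ be the expected number of queries made in a run with $T=T_g(\varepsilon)$ and with $T=T_f(\varepsilon)$, respectively ($+\infty$ if no such $T$ exists).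 Let $$\Delta=f(\tilde x_0)-f(x^\star)+\frac{\sigma^2}{L}\log n,\qquad \log_1 x=\max\{\log x,1\}.$$ **Theorem.** There is a universal constant $C$ such that, in every such situation, $$\mathbb E\,\mathrm{Comp}_g(\varepsilon)\le C\min\Big\{\frac{L^3}{\mu^3}+\frac{\sigma^3}{\varepsilon^3}+\log_1^3\frac{\mu\Delta}{\varepsilon^2},\ \ n^{3/2}+\Big(n+\frac{\sqrt nL}{\mu}\Big)\log_1\frac{L\Delta}{\sqrt n\,\varepsilon^2},\ \ \frac{(L\Delta)^{3/2}}{\varepsilon^3}\vee1,\ \ \frac{\sqrt nL\Delta}{\varepsilon^2}\vee1\Big\},$$ $$\mathbb E\,\mathrm{Comp}_f(\varepsilon)\le C\min\Big\{\frac{L^3}{\mu^3}+\frac{\sigma^3}{\mu^{3/2}\varepsilon^3}+\log_1^3\frac{\Delta}{\varepsilon^2},\ \ n^{3/2}+\Big(n+\frac{\sqrt nL}{\mu}\Big)\log_1\frac{\Delta}{\varepsilon^2}\Big\},$$ where the terms that involve $1/\mu$ are $+\infty$ if $\mu=0$. The bound on $\mathbb E\,\mathrm{Comp}_f$ and the first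 two bounds on $\mathbb E\,\mathrm{Comp}_g$ also hold if $R(T)$ is drawn with $\mathbb P(R(T)=j)\propto\eta_jm_j$ instead. The algorithm uses no knowledge of $\mu$, $\sigma$ or $\varepsilon$. -/

import Mathlib

open scoped ENNReal

noncomputable section

namespace GeomSarah

/-- Expectation of a `[0, ∞]`-valued function under a discrete law. -/
def expect {α : Type*} (p : PMF α) (g : α → ℝ≥0∞) : ℝ≥0∞ := ∑' a, p a * g a

/-- The finite-sum objective `F x = (1 / n) ∑ i, f i x`. -/
def objective {d n : ℕ} (f : Fin n → EuclideanSpace ℝ (Fin d) → ℝ)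
    (x : EuclideanSpace ℝ (Fin d)) : ℝ := (∑ i, f i x) / n

/-- Sampling `k` of the `n` indices uniformly without replacement, i.e. a uniformly random subset of
size `k` (only used with `k ≤ n`; the value `∅` for `k > n` is a placeholder). -/
def sampleSubset (n k : ℕ) : PMF (Finset (Fin n)) :=
  if h : (Finset.powersetCard k (Finset.univ : Finset (Fin n))).Nonempty then
    PMF.uniformOfFinset _ h
  else PMF.pure ∅

/-- The geometric law `P (N = k) = γ ^ k * (1 - γ)`, `k = 0, 1, 2, …`, with `γ = r / (1 + r)`,
so that its mean `γ / (1 - γ)` is `r`. -/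
def geometricLaw (r : NNReal) : PMF ℕ :=
  ⟨fun k => ENNReal.ofReal ((r / (1 + r) : ℝ) ^ k * (1 - r / (1 + r))), by
    have hr : (0 : ℝ) ≤ r := r.2
    have h0 : (0 : ℝ) ≤ r / (1 + r) := by positivity
    have h1 : (r / (1 + r) : ℝ) < 1 := by
      rw [div_lt_one (by positivity)]; linarith
    have hs : HasSum (fun k : ℕ => (r / (1 + r) : ℝ) ^ k * (1 - r / (1 + r))) 1 := by
      have := (hasSum_geometric_of_lt_one h0 h1).mul_right (1 - r / (1 + r) : ℝ)
      rwa [inv_mul_cancel₀ (by linarith)] at this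
    have hn : ∀ k : ℕ, (0 : ℝ) ≤ (r / (1 + r) : ℝ) ^ k * (1 - r / (1 + r)) :=
      fun k => mul_nonneg (pow_nonneg h0 k) (by linarith)
    have h := ENNReal.summable.hasSum (f := fun k : ℕ =>
      ENNReal.ofReal ((r / (1 + r) : ℝ) ^ k * (1 - r / (1 + r))))
    rwa [← ENNReal.ofReal_tsum_of_nonneg hn hs.summable, hs.tsum_eq, ENNReal.ofReal_one] at h⟩

/-- The inputs of Geom-SARAH: stepsizes `η j`, big-batch sizes `B j`, expected inner-loop queries
`m j`, mini-batch sizes `b j` (for the epochs `j = 1, 2, …`), the tail-randomized fraction `δ`, and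
the weights `w j` to which the law of the random output index is proportional. -/
structure Params where
  η : ℕ → ℝ
  B : ℕ → ℕ
  m : ℕ → ℕ
  b : ℕ → ℕ
  δ : ℝ
  w : ℕ → ℝ

variable {d n : ℕ}

/-- One inner-loop step. A state is `(x, v, q)`: the iterate, the gradient estimator, and the number
of IFO queries made so far; every sampled index is queried at the new and at the old iterate. -/
def innerStep (f : Fin n → EuclideanSpace ℝ (Fin d) → ℝ) (η : ℝ) (b : ℕ)
    (s : EuclideanSpace ℝ (Fin d) × EuclideanSpace ℝ (Fin d) × ℕ) :
    PMF (EuclideanSpace ℝ (Fin d) × EuclideanSpace ℝ (Fin d) × ℕ) :=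
  (sampleSubset n b).map fun I =>
    (s.1 - η • s.2.1,
      (b : ℝ)⁻¹ • ∑ i ∈ I, (gradient (f i) (s.1 - η • s.2.1) - gradient (f i) s.1) + s.2.1,
      s.2.2 + 2 * I.card)

/-- `k` inner-loop steps. -/
def innerLoop (f : Fin n → EuclideanSpace ℝ (Fin d) → ℝ) (η : ℝ) (b : ℕ) : ℕ →
    EuclideanSpace ℝ (Fin d) × EuclideanSpace ℝ (Fin d) × ℕ →
    PMF (EuclideanSpace ℝ (Fin d) × EuclideanSpace ℝ (Fin d) × ℕ)
  | 0, s => PMF.pure s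
  | k + 1, s => (innerLoop f η b k s).bind (innerStep f η b)

/-- The `j`-th epoch, as a transition of (iterate, number of IFO queries made so far):
a big-batch gradient estimator, followed by a geometrically distributed number of inner steps. -/
def epoch (P : Params) (f : Fin n → EuclideanSpace ℝ (Fin d) → ℝ) (j : ℕ)
    (s : EuclideanSpace ℝ (Fin d) × ℕ) : PMF (EuclideanSpace ℝ (Fin d) × ℕ) :=
  (sampleSubset n (P.B j)).bind fun J =>
    (geometricLaw ((P.m j : NNReal) / (P.b j : NNReal))).bind fun N =>
      (innerLoop f (P.η j) (P.b j) N
        (s.1, (P.B j : ℝ)⁻¹ • ∑ i ∈ J, gradient (f i) s.1, s.2 + J.card)).map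
        fun r => (r.1, r.2.2)

/-- The joint law of the iterate after the epochs `1, …, j` and of the number of IFO queries
made in them. -/
def run (P : Params) (f : Fin n → EuclideanSpace ℝ (Fin d) → ℝ)
    (x₀ : EuclideanSpace ℝ (Fin d)) : ℕ → PMF (EuclideanSpace ℝ (Fin d) × ℕ)
  | 0 => PMF.pure (x₀, 0)
  | j + 1 => (run P f x₀ j).bind (epoch P f (j + 1))

/-- The number `⌈(1 + δ) T⌉` of epochs that are run for the input `T`. -/
def numEpochs (P : Params) (T : ℕ) : ℕ := ⌈(1 + P.δ) * (T : ℝ)⌉₊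

/-- The weights of the output index: `w j` on `{T, …, ⌈(1 + δ) T⌉}`, zero elsewhere. -/
def tailWeight (P : Params) (T j : ℕ) : ℝ≥0∞ :=
  if j ∈ Finset.Icc T (numEpochs P T) then ENNReal.ofReal (P.w j) else 0

open Classical in
/-- The law of the output index `R(T)`, proportional to `w j` on `{T, …, ⌈(1 + δ) T⌉}`
(the value `T` if the weights cannot be normalized is a placeholder). -/
def outputIndex (P : Params) (T : ℕ) : PMF ℕ :=
  if h : ∑' j, tailWeight P T j ≠ 0 ∧ ∑' j, tailWeight P T j ≠ ∞ then
    PMF.normalize (tailWeight P T) h.1 h.2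
  else PMF.pure T

/-- The law of the output, the iterate after `R(T)` epochs, with `R(T)` drawn independently of
the epochs. -/
def output (P : Params) (f : Fin n → EuclideanSpace ℝ (Fin d) → ℝ)
    (x₀ : EuclideanSpace ℝ (Fin d)) (T : ℕ) : PMF (EuclideanSpace ℝ (Fin d)) :=
  (outputIndex P T).bind fun j => (run P f x₀ j).map Prod.fst

/-- The expected number of IFO queries made in a run with input `T`. -/
def expectedQueries (P : Params) (f : Fin n → EuclideanSpace ℝ (Fin d) → ℝ)
    (x₀ : EuclideanSpace ℝ (Fin d)) (T : ℕ) : ℝ≥0∞ :=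
  expect (run P f x₀ (numEpochs P T)) fun s => (s.2 : ℝ≥0∞)

open Classical in
/-- The expected number of IFO queries made in a run with input `min S`; `∞` if `S` is empty. -/
def complexityOf (P : Params) (f : Fin n → EuclideanSpace ℝ (Fin d) → ℝ)
    (x₀ : EuclideanSpace ℝ (Fin d)) (S : Set ℕ) : ℝ≥0∞ :=
  if S.Nonempty then expectedQueries P f x₀ (sInf S) else ∞

/-- `E Comp_g(ε)`: the expected IFO complexity with `T` the least positive integer from which on
the output satisfies `E ‖∇F‖² ≤ ε²`. -/
def compG (P : Params) (f : Fin n → EuclideanSpace ℝ (Fin d) → ℝ)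
    (x₀ : EuclideanSpace ℝ (Fin d)) (ε : ℝ) : ℝ≥0∞ :=
  complexityOf P f x₀ {T | 1 ≤ T ∧ ∀ T' ≥ T,
    expect (output P f x₀ T') (fun x => ENNReal.ofReal (‖gradient (objective f) x‖ ^ 2)) ≤
      ENNReal.ofReal (ε ^ 2)}

/-- `E Comp_f(ε)`: the expected IFO complexity with `T` the least positive integer from which on
the output satisfies `E (F - F x⋆) ≤ ε²`, where `x⋆` is a minimizer of `F`. -/
def compF (P : Params) (f : Fin n → EuclideanSpace ℝ (Fin d) → ℝ)
    (x₀ xstar : EuclideanSpace ℝ (Fin d)) (ε : ℝ) : ℝ≥0∞ :=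
  complexityOf P f x₀ {T | 1 ≤ T ∧ ∀ T' ≥ T,
    expect (output P f x₀ T') (fun x => ENNReal.ofReal (objective f x - objective f xstar)) ≤
      ENNReal.ofReal (ε ^ 2)}

/-- Q-Geom-SARAH: `m j = B j = min (j ^ 2) n`, `η j = b j / (2 L √(m j))`, `δ = 1`, output index
weighted by `λ j = η j * m j / b j`, the stepsize times the expected number of inner steps. -/
def qGeomSarah (n : ℕ) (L : ℝ) (b : ℕ → ℕ) : Params where
  η j := b j / (2 * L * √((min (j ^ 2) n : ℕ) : ℝ))
  B j := min (j ^ 2) n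
  m j := min (j ^ 2) n
  b := b
  δ := 1
  w j := b j / (2 * L * √((min (j ^ 2) n : ℕ) : ℝ)) * ((min (j ^ 2) n : ℕ) : ℝ) / b j

/-- Q-Geom-SARAH with the output index weighted by `η j * m j` instead. -/
def qGeomSarah' (n : ℕ) (L : ℝ) (b : ℕ → ℕ) : Params :=
  { qGeomSarah n L b with
    w := fun j => (qGeomSarah n L b).η j * ((qGeomSarah n L b).m j : ℝ) }

/-- `(log x) ∨ 1`, the meaning of `log x` inside a big-O. -/
def logOne (x : ℝ) : ℝ := max (Real.log x) 1

end GeomSarah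

end

open scoped ENNReal

noncomputable section

namespace GeomSarah

section

/-! ### Calculus of expectations with values in `[0, ∞]`, where no integrability is needed. -/

section Expect

variable {α β : Type*}

/-! Within an epoch, smoothness gives a descent inequality whose only harmful term is the squared
error `e` of the estimator `v`, and which leaves a spare `-(η/4)‖v‖²`. The error grows per step by
at most `(L²η²/b)‖v‖²` in mean, because its increments are centred. For a geometric `N` with mean
`r`, any sequence `D` satisfies `r E(D_{N+1} - D_N) = E D_N - D_0`, so one-step bounds become bounds
at the random end of the epoch, with no sum over the steps (`expect_geometricLaw_le`). If `r L²η²/b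
≤ 1/4`, the spare term absorbs the growth of the error.

With the chosen step sizes this condition is an equality. Writing `A j`, `G j` for the expected gap
and squared gradient norm after epoch `j`, and `s j = √(m j) = min(j, √n)`, one gets
(`expect_run_succ_le`) `A (j+1) + (s (j+1) / 4L) G (j+1) ≤ A j + ν (j+1)`, where `ν j = σ²/(4Lj)`
while `j² < n` and `ν j = 0` afterwards, since a full batch has no error. The noise sums to at most
`(σ²/L) log n`, hence `Δ`. All the rest is deterministic.

Without PL, telescope: the weights of the output are proportional to `s j`, and `T s(T) ≥ 4LΔ/ε²`
suffices. With PL, the gap contracts by `1 + s μ/(2L)` per epoch. Past `√n` epochs this is linear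
convergence without noise (`exists_index_fullBatch`). If `8L/μ ≤ √n`, then past `8L/μ` epochs the
factor is at most `1/5`, and the gap follows the slowly varying noise level `σ²/(μj²)`
(`exists_index_adaptive`). If `8L/μ > √n`, the full-batch bound already implies the adaptive one
(`fullBatch_le_adaptive`). Under PL all late iterates are accurate, so the output weights are
irrelevant. Finally, `T` costs at most `min(24T³, 6nT)` queries. -/

lemma expect_pure (a : α) (g : α → ℝ≥0∞) : expect (PMF.pure a) g = g a := by
  classical
  unfold expect
  rw [tsum_eq_single a]
  · simp
  · intro b hb
    simp [PMF.pure_apply, hb]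

lemma expect_bind (p : PMF α) (k : α → PMF β) (g : β → ℝ≥0∞) :
    expect (p.bind k) g = expect p fun a => expect (k a) g := by
  unfold expect
  simp only [PMF.bind_apply, ← ENNReal.tsum_mul_right, ← ENNReal.tsum_mul_left]
  rw [ENNReal.tsum_comm]
  simp only [mul_assoc]

lemma expect_map (p : PMF α) (k : α → β) (g : β → ℝ≥0∞) :
    expect (p.map k) g = expect p fun a => g (k a) := by
  rw [← PMF.bind_pure_comp, expect_bind]
  simp [expect_pure]

lemma expect_add (p : PMF α) (g h : α → ℝ≥0∞) :
    expect p (fun a => g a + h a) = expect p g + expect p h := by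
  simp [expect, mul_add, ENNReal.tsum_add]

lemma expect_const_mul (p : PMF α) (c : ℝ≥0∞) (g : α → ℝ≥0∞) :
    expect p (fun a => c * g a) = c * expect p g := by
  simp only [expect, ← ENNReal.tsum_mul_left]
  exact tsum_congr fun a => by ring

lemma expect_const (p : PMF α) (c : ℝ≥0∞) : expect p (fun _ => c) = c := by
  simp [expect, ENNReal.tsum_mul_right, p.tsum_coe]

lemma expect_mono {p : PMF α} {g h : α → ℝ≥0∞} (H : ∀ a, g a ≤ h a) :
    expect p g ≤ expect p h :=
  ENNReal.tsum_le_tsum fun a => by gcongr; exact H a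

lemma expect_congr_of_mem_support {p : PMF α} {g h : α → ℝ≥0∞}
    (H : ∀ a ∈ p.support, g a = h a) : expect p g = expect p h := by
  refine tsum_congr fun a => ?_
  by_cases ha : p a = 0
  · simp [ha]
  · rw [H a ((p.mem_support_iff a).2 ha)]

end Expect

/-! ### Variance of sampling without replacement. -/

section Sampling

variable {n k : ℕ}

lemma sampleSubset_eq (hk : k ≤ n) :
    ∃ h : (Finset.powersetCard k (Finset.univ : Finset (Fin n))).Nonempty,
      sampleSubset n k = PMF.uniformOfFinset _ h := by
  have h : (Finset.powersetCard k (Finset.univ : Finset (Fin n))).Nonempty := by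
    rw [Finset.powersetCard_nonempty]; simpa using hk
  exact ⟨h, by simp [sampleSubset, h]⟩

lemma card_of_mem_support_sampleSubset (hk : k ≤ n) {I : Finset (Fin n)}
    (hI : I ∈ (sampleSubset n k).support) : I.card = k := by
  obtain ⟨h, e⟩ := sampleSubset_eq hk
  rw [e, PMF.mem_support_uniformOfFinset_iff] at hI
  exact (Finset.mem_powersetCard.1 hI).2

lemma expect_sampleSubset_ofReal (hk : k ≤ n) (g : Finset (Fin n) → ℝ) (hg : ∀ I, 0 ≤ g I) :
    expect (sampleSubset n k) (fun I => ENNReal.ofReal (g I)) =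
      ENNReal.ofReal ((∑ I ∈ Finset.powersetCard k Finset.univ, g I) / (n.choose k)) := by
  obtain ⟨h, e⟩ := sampleSubset_eq hk
  have hpos : (0 : ℝ) < n.choose k := by exact_mod_cast Nat.choose_pos hk
  unfold expect
  rw [e, tsum_eq_sum (s := Finset.powersetCard k Finset.univ)]
  · rw [ENNReal.ofReal_div_of_pos hpos, ENNReal.ofReal_sum_of_nonneg fun I _ => hg I,
      ENNReal.div_eq_inv_mul, Finset.mul_sum]
    refine Finset.sum_congr rfl fun I hI => ?_
    rw [PMF.uniformOfFinset_apply_of_mem _ hI]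
    simp
  · intro I hI
    rw [PMF.uniformOfFinset_apply_of_notMem _ hI, zero_mul]

/-- Only the independence of the pair matters: a common weight `c` on the off-diagonal products lets
them be summed using `∑ z i = 0`. -/
lemma card_filter_pair_mem_powersetCard (n k : ℕ) :
    ∃ c : ℕ, ∀ i j : Fin n, i ≠ j →
      ((Finset.powersetCard k Finset.univ).filter fun I : Finset (Fin n) => i ∈ I ∧ j ∈ I).card
        = c := by
  by_cases hk : 2 ≤ k
  · refine ⟨(n - 2).choose (k - 2), fun i j hij => ?_⟩
    have hc : ({i, j} : Finset (Fin n)).card = 2 := Finset.card_pair hij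
    have := Finset.card_filter_powersetCard_subset ({i, j} : Finset (Fin n)) Finset.univ k
      (Finset.subset_univ _) (by omega)
    simpa [hc, Finset.insert_subset_iff] using this
  · refine ⟨0, fun i j hij => ?_⟩
    rw [Finset.card_eq_zero, Finset.filter_eq_empty_iff]
    rintro I hI ⟨hi, hj⟩
    have hc : ({i, j} : Finset (Fin n)).card = 2 := Finset.card_pair hij
    have hs : ({i, j} : Finset (Fin n)) ⊆ I := by simp [Finset.insert_subset_iff, hi, hj]
    have := Finset.card_le_card hs
    have := (Finset.mem_powersetCard.1 hI).2
    omega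

lemma card_filter_mem_powersetCard (hk : 1 ≤ k) (i : Fin n) :
    ((Finset.powersetCard k Finset.univ).filter fun I : Finset (Fin n) => i ∈ I).card
      = (n - 1).choose (k - 1) := by
  have := Finset.card_filter_powersetCard_subset ({i} : Finset (Fin n)) Finset.univ k
      (Finset.subset_univ _) (by simpa using hk)
  simpa using this

variable {V : Type*} [NormedAddCommGroup V] [InnerProductSpace ℝ V]

lemma sum_powersetCard_sum (hk : 1 ≤ k) (z : Fin n → V) :
    ∑ I ∈ Finset.powersetCard k (Finset.univ : Finset (Fin n)), ∑ i ∈ I, z i =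
      ((n - 1).choose (k - 1) : ℝ) • ∑ i, z i := by
  have h1 : ∀ I : Finset (Fin n), ∑ i ∈ I, z i = ∑ i, if i ∈ I then z i else 0 := by
    intro I; simp
  rw [Finset.sum_congr rfl fun I _ => h1 I, Finset.sum_comm, Finset.smul_sum]
  refine Finset.sum_congr rfl fun i _ => ?_
  rw [← Finset.sum_filter, Finset.sum_const, card_filter_mem_powersetCard hk, Nat.cast_smul_eq_nsmul]

/-- Expand the square. The off-diagonal products all occur equally often, and for centred `z` they
sum to `-∑ ‖z i‖²`. Their contribution is thus nonpositive and can be dropped. -/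
lemma sum_powersetCard_norm_sq_le (hk : 1 ≤ k) (z : Fin n → V) (hz : ∑ i, z i = 0) :
    ∑ I ∈ Finset.powersetCard k (Finset.univ : Finset (Fin n)), ‖∑ i ∈ I, z i‖ ^ 2 ≤
      ((n - 1).choose (k - 1) : ℝ) * ∑ i, ‖z i‖ ^ 2 := by
  obtain ⟨c, hc⟩ := card_filter_pair_mem_powersetCard n k
  have h1 : ∀ I : Finset (Fin n), ‖∑ i ∈ I, z i‖ ^ 2 =
      ∑ i, ∑ j, if i ∈ I ∧ j ∈ I then inner ℝ (z i) (z j) else 0 := by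
    intro I
    rw [← real_inner_self_eq_norm_sq, sum_inner]
    simp_rw [inner_sum]
    rw [← Finset.sum_filter_add_sum_filter_not Finset.univ (fun i => i ∈ I)]
    rw [Finset.sum_eq_zero (s := Finset.univ.filter fun i => ¬ i ∈ I)]
    · rw [Finset.filter_univ_mem, add_zero]
      refine Finset.sum_congr rfl fun i hi => ?_
      simp [hi]
    · intro i hi
      have : i ∉ I := by simpa using hi
      simp [this]
  simp_rw [h1]
  have h2 : ∑ I ∈ Finset.powersetCard k (Finset.univ : Finset (Fin n)),
      ∑ i, ∑ j, (if i ∈ I ∧ j ∈ I then inner ℝ (z i) (z j) else 0) =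
      ∑ i, ∑ j, (((Finset.powersetCard k Finset.univ).filter
        fun I : Finset (Fin n) => i ∈ I ∧ j ∈ I).card : ℝ) * inner ℝ (z i) (z j) := by
    rw [Finset.sum_comm]
    refine Finset.sum_congr rfl fun i _ => ?_
    rw [Finset.sum_comm]
    refine Finset.sum_congr rfl fun j _ => ?_
    rw [← Finset.sum_filter, Finset.sum_const, nsmul_eq_mul]
  rw [h2, Finset.mul_sum]
  have h3 : ∑ i, ∑ j, inner ℝ (z i) (z j) = (0 : ℝ) := by
    simp_rw [← inner_sum, hz, inner_zero_right, Finset.sum_const_zero]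
  have h4 : ∀ i, ∑ j, (((Finset.powersetCard k Finset.univ).filter
        fun I : Finset (Fin n) => i ∈ I ∧ j ∈ I).card : ℝ) * inner ℝ (z i) (z j) =
      (((n - 1).choose (k - 1) : ℝ) - c) * ‖z i‖ ^ 2 + c * ∑ j, inner ℝ (z i) (z j) := by
    intro i
    rw [← Finset.add_sum_erase _ _ (Finset.mem_univ i),
      ← Finset.add_sum_erase _ (fun j => inner ℝ (z i) (z j)) (Finset.mem_univ i)]
    rw [Finset.sum_congr rfl (g := fun j => (c : ℝ) * inner ℝ (z i) (z j))]
    · rw [← Finset.mul_sum]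
      simp only [and_self, card_filter_mem_powersetCard hk, real_inner_self_eq_norm_sq]
      ring
    · intro j hj
      rw [hc i j (Finset.ne_of_mem_erase hj).symm]
  simp_rw [h4]
  rw [Finset.sum_add_distrib, ← Finset.mul_sum, ← Finset.mul_sum, h3, mul_zero, add_zero,
    ← Finset.mul_sum]
  have : 0 ≤ ∑ i, ‖z i‖ ^ 2 := Finset.sum_nonneg fun i _ => sq_nonneg _
  nlinarith [mul_nonneg (Nat.cast_nonneg (α := ℝ) c) this]

lemma choose_mul_eq (hk : 1 ≤ k) (hkn : k ≤ n) :
    (n.choose k : ℝ) * k = n * ((n - 1).choose (k - 1) : ℝ) := by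
  obtain ⟨k, rfl⟩ := Nat.exists_eq_succ_of_ne_zero (by omega : k ≠ 0)
  obtain ⟨n, rfl⟩ := Nat.exists_eq_succ_of_ne_zero (by omega : n ≠ 0)
  have := Nat.add_one_mul_choose_eq n k
  simp only [Nat.succ_eq_add_one, Nat.add_sub_cancel]
  exact_mod_cast this.symm

/-- The mean of `k` vectors sampled without replacement has variance at most `1 / k` times the
population variance; `u` is a deterministic offset. -/
lemma expect_sampleSubset_norm_sq_le (hk : 1 ≤ k) (hkn : k ≤ n) (y : Fin n → V) (ybar u : V)
    (hy : ∑ i, y i = (n : ℝ) • ybar) :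
    expect (sampleSubset n k)
        (fun I => ENNReal.ofReal (‖(k : ℝ)⁻¹ • ∑ i ∈ I, y i - ybar + u‖ ^ 2)) ≤
      ENNReal.ofReal (‖u‖ ^ 2 + (∑ i, ‖y i - ybar‖ ^ 2) / n / k) := by
  rw [expect_sampleSubset_ofReal hkn _ fun I => sq_nonneg _]
  apply ENNReal.ofReal_le_ofReal
  have hpos : (0 : ℝ) < n.choose k := by exact_mod_cast Nat.choose_pos hkn
  have hk0 : (0 : ℝ) < k := by exact_mod_cast hk
  have hn0 : (0 : ℝ) < n := by exact_mod_cast hk.trans hkn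
  rw [div_le_iff₀ hpos]
  set z : Fin n → V := fun i => y i - ybar with hz
  have hz0 : ∑ i, z i = 0 := by
    simp [hz, Finset.sum_sub_distrib, hy, ← Nat.cast_smul_eq_nsmul ℝ]
  have h1 : ∀ I ∈ Finset.powersetCard k (Finset.univ : Finset (Fin n)),
      ‖(k : ℝ)⁻¹ • ∑ i ∈ I, y i - ybar + u‖ ^ 2 =
        (k : ℝ)⁻¹ ^ 2 * ‖∑ i ∈ I, z i‖ ^ 2 + 2 * (k : ℝ)⁻¹ * inner ℝ (∑ i ∈ I, z i) u
          + ‖u‖ ^ 2 := by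
    intro I hI
    have hc := (Finset.mem_powersetCard.1 hI).2
    have : (k : ℝ)⁻¹ • ∑ i ∈ I, y i - ybar = (k : ℝ)⁻¹ • ∑ i ∈ I, z i := by
      simp only [hz, Finset.sum_sub_distrib, Finset.sum_const, hc, smul_sub,
        ← Nat.cast_smul_eq_nsmul ℝ, smul_smul]
      rw [inv_mul_cancel₀ hk0.ne', one_smul]
    rw [this, norm_add_sq_real, norm_smul, mul_pow, real_inner_smul_left]
    simp only [norm_inv, RCLike.norm_natCast]
    ring
  rw [Finset.sum_congr rfl h1, Finset.sum_add_distrib, Finset.sum_add_distrib, ← Finset.mul_sum,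
    ← Finset.mul_sum, ← sum_inner, sum_powersetCard_sum hk, hz0, Finset.sum_const,
    Finset.card_powersetCard]
  simp only [smul_zero, inner_zero_left, mul_zero, add_zero, Finset.card_univ, Fintype.card_fin,
    nsmul_eq_mul]
  have h2 := sum_powersetCard_norm_sq_le hk z hz0
  have h3 := choose_mul_eq hk hkn
  have h4 : (∑ i, ‖z i‖ ^ 2) / n / k * (n.choose k) =
      (k : ℝ)⁻¹ ^ 2 * (((n - 1).choose (k - 1) : ℝ) * ∑ i, ‖z i‖ ^ 2) := by
    field_simp
    linear_combination (∑ i, ‖z i‖ ^ 2) * h3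
  have h5 := mul_le_mul_of_nonneg_left h2 (sq_nonneg (k : ℝ)⁻¹)
  rw [add_mul]
  have h6 : (∑ i, ‖y i - ybar‖ ^ 2) = ∑ i, ‖z i‖ ^ 2 := rfl
  rw [h6, h4]
  linarith

/-- The only subset of size `n` is the whole set. The general variance bound would leave a term of
order `1 / n`; the exact zero is what removes the noise from full-batch epochs. -/
lemma expect_sampleSubset_self_norm_sq (hn : 1 ≤ n) (y : Fin n → V) (ybar : V)
    (hy : ∑ i, y i = (n : ℝ) • ybar) :
    expect (sampleSubset n n)
        (fun I => ENNReal.ofReal (‖(n : ℝ)⁻¹ • ∑ i ∈ I, y i - ybar‖ ^ 2)) = 0 := by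
  have hn0 : (n : ℝ) ≠ 0 := by positivity
  rw [expect_congr_of_mem_support (h := fun _ => 0), expect_const]
  intro I hI
  have hc := card_of_mem_support_sampleSubset le_rfl hI
  have : I = Finset.univ := by
    rw [← Finset.card_eq_iff_eq_univ, hc, Fintype.card_fin]
  rw [this, hy, smul_smul, inv_mul_cancel₀ hn0, one_smul]
  simp

lemma sum_norm_sub_mean_sq_le (y : Fin n → V) (ybar : V) (hy : ∑ i, y i = (n : ℝ) • ybar) :
    ∑ i, ‖y i - ybar‖ ^ 2 ≤ ∑ i, ‖y i‖ ^ 2 := by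
  have h : ∀ i, ‖y i - ybar‖ ^ 2 = ‖y i‖ ^ 2 - 2 * inner ℝ (y i) ybar + ‖ybar‖ ^ 2 :=
    fun i => norm_sub_sq_real _ _
  simp_rw [h]
  rw [Finset.sum_add_distrib, Finset.sum_sub_distrib, ← Finset.mul_sum, ← sum_inner, hy,
    real_inner_smul_left, real_inner_self_eq_norm_sq]
  simp only [Finset.sum_const, Finset.card_univ, Fintype.card_fin, nsmul_eq_mul]
  nlinarith [mul_nonneg (Nat.cast_nonneg (α := ℝ) n) (sq_nonneg ‖ybar‖)]

end Sampling

/-! ### Stopping at a geometric time. -/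

section Geometric

lemma geometricLaw_apply (r : NNReal) (k : ℕ) : geometricLaw r k =
    ENNReal.ofReal ((r / (1 + r) : ℝ) ^ k * (1 - r / (1 + r))) := rfl

lemma expect_geometricLaw_natCast (r : NNReal) :
    expect (geometricLaw r) (fun k => (k : ℝ≥0∞)) = r := by
  set γ : ℝ := r / (1 + r) with hγ
  have hr : (0 : ℝ) ≤ r := r.2
  have h0 : 0 ≤ γ := by positivity
  have h1 : γ < 1 := by
    rw [hγ, div_lt_one (by positivity)]; linarith
  have hs := (hasSum_coe_mul_geometric_of_norm_lt_one
    (by rwa [Real.norm_of_nonneg h0] : ‖γ‖ < 1)).mul_right (1 - γ)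
  have h2 : ∀ k : ℕ, geometricLaw r k * (k : ℝ≥0∞) =
      ENNReal.ofReal (k * γ ^ k * (1 - γ)) := by
    intro k
    rw [geometricLaw_apply, ← ENNReal.ofReal_natCast k, ← ENNReal.ofReal_mul]
    · congr 1; rw [← hγ]; ring
    · exact mul_nonneg (pow_nonneg h0 k) (by linarith)
  unfold expect
  simp_rw [h2]
  rw [← ENNReal.ofReal_tsum_of_nonneg _ hs.summable, hs.tsum_eq]
  · have : γ / (1 - γ) ^ 2 * (1 - γ) = r := by
      have h3 : 1 - γ = 1 / (1 + r) := by rw [hγ]; field_simp; ring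
      rw [h3, hγ]; field_simp
    rw [this, ENNReal.ofReal_coe_nnreal]
  · intro k
    exact mul_nonneg (mul_nonneg (Nat.cast_nonneg _) (pow_nonneg h0 k)) (by linarith)

/-- Abel summation against the geometric law with mean `r`, truncated at `K`. -/
lemma sum_geometric_mul_succ_sub_ge {γ r : ℝ} (hγ : 0 < γ) (hr : r * (1 - γ) = γ)
    (e : ℕ → ℝ) (he : ∀ k, 0 ≤ e k) (K : ℕ) :
    ∑ k ∈ Finset.range K, γ ^ k * (1 - γ) * e k - e 0 ≤
      r * ∑ k ∈ Finset.range K, γ ^ k * (1 - γ) * (e (k + 1) - e k) := by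
  suffices h : ∑ k ∈ Finset.range K, γ ^ k * (1 - γ) * e k + (γ ^ K * e K) - e 0 ≤
      r * ∑ k ∈ Finset.range K, γ ^ k * (1 - γ) * (e (k + 1) - e k) by
    have := mul_nonneg (pow_nonneg hγ.le K) (he K)
    linarith
  induction K with
  | zero => simp
  | succ K ih =>
    rw [Finset.sum_range_succ, Finset.sum_range_succ, mul_add]
    have : r * (γ ^ K * (1 - γ) * (e (K + 1) - e K)) = γ ^ (K + 1) * (e (K + 1) - e K) := by
      rw [pow_succ]; linear_combination γ ^ K * (e (K + 1) - e K) * hr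
    rw [this, pow_succ]
    linarith

/-- The geometrization argument: one-step bounds for `a` (gap), `g` (squared gradient norm),
`w` (squared norm of the estimator) and `e` (squared error of the estimator) give a bound at a
geometric time. -/
lemma expect_geometricLaw_le (r : NNReal) (hr : 0 < r) {h c : ℝ} (hh : 0 < h) (hc : 0 ≤ c)
    (hrc : r * c ≤ 1 / 4) (a g w e : ℕ → ℝ≥0∞) (ha0 : a 0 ≠ ∞) (he0 : e 0 ≠ ∞)
    (hstep : ∀ k, a (k + 1) + ENNReal.ofReal (h / 2) * g k + ENNReal.ofReal (h / 4) * w k ≤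
      a k + ENNReal.ofReal (h / 2) * e k)
    (herr : ∀ k, e (k + 1) ≤ e k + ENNReal.ofReal c * w k) :
    expect (geometricLaw r) (fun k => a k + ENNReal.ofReal (r * h / 2) * g k) ≤
      a 0 + ENNReal.ofReal (r * h / 2) * e 0 := by
  -- Differences are needed, so the argument moves to real numbers. Finiteness propagates from `a 0`
  -- and `e 0`: in `hstep` the terms `g k` and `w k` have positive coefficients on the smaller side.
  have hfin : ∀ k, a k ≠ ∞ ∧ e k ≠ ∞ ∧ g k ≠ ∞ ∧ w k ≠ ∞ := by
    have key : ∀ k, a k ≠ ∞ → e k ≠ ∞ → a (k + 1) ≠ ∞ ∧ g k ≠ ∞ ∧ w k ≠ ∞ := by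
      intro k ha he
      have hR : a k + ENNReal.ofReal (h / 2) * e k ≠ ∞ :=
        ENNReal.add_ne_top.2 ⟨ha, ENNReal.mul_ne_top ENNReal.ofReal_ne_top he⟩
      have hL := ne_top_of_le_ne_top hR (hstep k)
      rw [ENNReal.add_ne_top, ENNReal.add_ne_top] at hL
      obtain ⟨⟨h1, h2⟩, h3⟩ := hL
      refine ⟨h1, ?_, ?_⟩
      · rintro hg
        rw [hg, ENNReal.mul_top (by simpa using hh)] at h2
        exact h2 rfl
      · rintro hg
        rw [hg, ENNReal.mul_top (by simpa using hh)] at h3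
        exact h3 rfl
    have hae : ∀ k, a k ≠ ∞ ∧ e k ≠ ∞ := by
      intro k
      induction k with
      | zero => exact ⟨ha0, he0⟩
      | succ k ih =>
        have := key k ih.1 ih.2
        exact ⟨this.1, ne_top_of_le_ne_top
          (ENNReal.add_ne_top.2 ⟨ih.2, ENNReal.mul_ne_top ENNReal.ofReal_ne_top this.2.2⟩)
          (herr k)⟩
    exact fun k => ⟨(hae k).1, (hae k).2, (key k (hae k).1 (hae k).2).2⟩
  obtain ⟨a', rfl⟩ : ∃ a' : ℕ → NNReal, a = fun k => (a' k : ℝ≥0∞) :=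
    ⟨fun k => (a k).toNNReal, funext fun k => (ENNReal.coe_toNNReal (hfin k).1).symm⟩
  obtain ⟨e', rfl⟩ : ∃ a' : ℕ → NNReal, e = fun k => (a' k : ℝ≥0∞) :=
    ⟨fun k => (e k).toNNReal, funext fun k => (ENNReal.coe_toNNReal (hfin k).2.1).symm⟩
  obtain ⟨g', rfl⟩ : ∃ a' : ℕ → NNReal, g = fun k => (a' k : ℝ≥0∞) :=
    ⟨fun k => (g k).toNNReal, funext fun k => (ENNReal.coe_toNNReal (hfin k).2.2.1).symm⟩
  obtain ⟨w', rfl⟩ : ∃ a' : ℕ → NNReal, w = fun k => (a' k : ℝ≥0∞) :=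
    ⟨fun k => (w k).toNNReal, funext fun k => (ENNReal.coe_toNNReal (hfin k).2.2.2).symm⟩
  have hcoe : ∀ (t : ℝ) (x : NNReal), 0 ≤ t →
      ENNReal.ofReal t * (x : ℝ≥0∞) = ENNReal.ofReal (t * x) := fun t x ht => by
    rw [ENNReal.ofReal_mul ht, ENNReal.ofReal_coe_nnreal]
  have hcoe' : ∀ x : NNReal, (x : ℝ≥0∞) = ENNReal.ofReal x := fun x =>
    (ENNReal.ofReal_coe_nnreal).symm
  have hr0 : (0 : ℝ) < r := hr
  beta_reduce at hstep herr ⊢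
  have hstep' : ∀ k, (a' (k + 1) : ℝ) + h / 2 * g' k + h / 4 * w' k ≤ a' k + h / 2 * e' k := by
    intro k
    have := hstep k
    rw [hcoe _ _ (by positivity), hcoe _ _ (by positivity), hcoe _ _ (by positivity),
      hcoe' (a' (k + 1)), hcoe' (a' k), ← ENNReal.ofReal_add (by positivity) (by positivity),
      ← ENNReal.ofReal_add (by positivity) (by positivity),
      ← ENNReal.ofReal_add (by positivity) (by positivity),
      ENNReal.ofReal_le_ofReal_iff (by positivity)] at this
    exact this
  have herr' : ∀ k, (e' (k + 1) : ℝ) ≤ e' k + c * w' k := by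
    intro k
    have := herr k
    rw [hcoe _ _ (by positivity), hcoe' (e' (k + 1)), hcoe' (e' k),
      ← ENNReal.ofReal_add (by positivity) (by positivity),
      ENNReal.ofReal_le_ofReal_iff (by positivity)] at this
    exact this
  set γ : ℝ := r / (1 + r) with hγ
  have hγ0 : 0 < γ := by positivity
  have hγ1 : 1 - γ = 1 / (1 + r) := by rw [hγ]; field_simp; ring
  have hγ1' : 0 < 1 - γ := by rw [hγ1]; positivity
  have hrγ : (r : ℝ) * (1 - γ) = γ := by rw [hγ1, hγ]; ring
  -- Truncating at `K` avoids any summability question; the expectation is the supremum of these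
  -- partial sums.
  have hsum : ∀ K : ℕ, ∑ k ∈ Finset.range K,
      γ ^ k * (1 - γ) * ((a' k : ℝ) + r * h / 2 * g' k) ≤ a' 0 + r * h / 2 * e' 0 := by
    intro K
    set S : (ℕ → ℝ) → ℝ := fun u => ∑ k ∈ Finset.range K, γ ^ k * (1 - γ) * u k with hS
    have Smono : ∀ u v : ℕ → ℝ, (∀ k, u k ≤ v k) → S u ≤ S v := fun u v H =>
      Finset.sum_le_sum fun k _ => mul_le_mul_of_nonneg_left (H k)
        (mul_nonneg (pow_nonneg hγ0.le k) hγ1'.le)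
    have Sadd : ∀ u v : ℕ → ℝ, S (fun k => u k + v k) = S u + S v := fun u v => by
      simp only [hS, mul_add, Finset.sum_add_distrib]
    have Smul : ∀ (t : ℝ) (u : ℕ → ℝ), S (fun k => t * u k) = t * S u := fun t u => by
      simp only [hS, Finset.mul_sum]
      exact Finset.sum_congr rfl fun k _ => by ring
    have Ha := sum_geometric_mul_succ_sub_ge hγ0 hrγ (fun k => (a' k : ℝ))
      (fun k => (a' k).2) K
    have He := sum_geometric_mul_succ_sub_ge hγ0 hrγ (fun k => (e' k : ℝ))
      (fun k => (e' k).2) K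
    have He2 := Smono (fun k => (e' (k + 1) : ℝ) - e' k) (fun k => c * w' k)
      (fun k => by linarith [herr' k])
    have Ha2 := Smono (fun k => ((a' (k + 1) : ℝ) - a' k))
      (fun k => (-(h / 2) * g' k + -(h / 4) * w' k) + h / 2 * e' k)
      (fun k => by linarith [hstep' k])
    rw [Smul] at He2
    rw [Sadd, Sadd, Smul, Smul, Smul] at Ha2
    change S (fun k => (a' k : ℝ)) - a' 0 ≤ r * S (fun k => ((a' (k + 1) : ℝ) - a' k)) at Ha
    change S (fun k => (e' k : ℝ)) - e' 0 ≤ r * S (fun k => ((e' (k + 1) : ℝ) - e' k)) at He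
    change S (fun k => (a' k : ℝ) + r * h / 2 * g' k) ≤ _
    rw [Sadd, Smul]
    have hw : 0 ≤ S (fun k => (w' k : ℝ)) := Finset.sum_nonneg fun k _ =>
      mul_nonneg (mul_nonneg (pow_nonneg hγ0.le k) hγ1'.le) (w' k).2
    generalize S (fun k => (w' k : ℝ)) = Sw at *
    generalize S (fun k => (g' k : ℝ)) = Sg at *
    generalize S (fun k => (e' k : ℝ)) = Se at *
    generalize S (fun k => (a' k : ℝ)) = Sa at *
    -- By `r c ≤ 1/4`. The error then contributes at most `(rh/8) Sw`, which the descent term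
    -- `-(rh/4) Sw` absorbs.
    have He3 : Se ≤ e' 0 + 1 / 4 * Sw := by
      nlinarith [mul_le_mul_of_nonneg_left He2 hr0.le, mul_le_mul_of_nonneg_right hrc hw]
    have Ha3 := mul_le_mul_of_nonneg_left Ha2 hr0.le
    have hrh : 0 < r * h := by positivity
    nlinarith [mul_le_mul_of_nonneg_left He3 hrh.le, mul_nonneg hrh.le hw]
  unfold expect
  have hterm : ∀ k, geometricLaw r k * ((a' k : ℝ≥0∞) + ENNReal.ofReal (r * h / 2) * g' k) =
      ENNReal.ofReal (γ ^ k * (1 - γ) * ((a' k : ℝ) + r * h / 2 * g' k)) := by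
    intro k
    rw [geometricLaw_apply, hcoe _ _ (by positivity), hcoe' (a' k),
      ← ENNReal.ofReal_add (by positivity) (by positivity), ← ENNReal.ofReal_mul]
    exact mul_nonneg (pow_nonneg hγ0.le k) hγ1'.le
  simp_rw [hterm]
  rw [hcoe _ _ (by positivity), hcoe' (a' 0), ← ENNReal.ofReal_add (by positivity) (by positivity),
    ENNReal.tsum_eq_iSup_nat]
  refine iSup_le fun K => ?_
  rw [← ENNReal.ofReal_sum_of_nonneg]
  · exact ENNReal.ofReal_le_ofReal (hsum K)
  · intro k _
    have := mul_nonneg (pow_nonneg hγ0.le k) hγ1'.le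
    positivity

end Geometric

end

/-! ### Descent within an epoch. -/

section

variable {d n : ℕ}

section Descent

variable {V : Type*} [NormedAddCommGroup V] [InnerProductSpace ℝ V] [CompleteSpace V]

/-- The descent lemma for functions with Lipschitz gradient. -/
lemma le_add_inner_add_of_lipschitz_gradient {F : V → ℝ} {L : ℝ} (hF : Differentiable ℝ F)
    (hL : ∀ x y, ‖gradient F x - gradient F y‖ ≤ L * ‖x - y‖) (x h : V) :
    F (x + h) ≤ F x + inner ℝ (gradient F x) h + L / 2 * ‖h‖ ^ 2 := by
  -- The derivative of `φ` is nonpositive on `(0, 1)` by Cauchy–Schwarz and the Lipschitz bound; the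
  -- claim is `φ 1 ≤ φ 0`.
  set φ : ℝ → ℝ := fun t => F (x + t • h) - t * inner ℝ (gradient F x) h - L / 2 * ‖h‖ ^ 2 * t ^ 2
    with hφ
  have hder : ∀ t, HasDerivAt φ
      (inner ℝ (gradient F (x + t • h)) h - inner ℝ (gradient F x) h - L * ‖h‖ ^ 2 * t) t := by
    intro t
    have h1 : HasDerivAt (fun t : ℝ => x + t • h) h t := by
      simpa using ((hasDerivAt_id t).smul_const h).const_add x
    have h2 := (hF (x + t • h)).hasGradientAt.hasFDerivAt.comp_hasDerivAt t h1
    have h3 := (h2.sub ((hasDerivAt_id t).mul_const (inner ℝ (gradient F x) h))).sub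
      (((hasDerivAt_id t).pow 2).const_mul (L / 2 * ‖h‖ ^ 2))
    refine h3.congr_deriv ?_
    simp only [InnerProductSpace.toDual_apply_apply, id_eq]
    ring
  have hanti : AntitoneOn φ (Set.Icc 0 1) := by
    refine antitoneOn_of_deriv_nonpos (convex_Icc 0 1)
      (fun t _ => (hder t).continuousAt.continuousWithinAt)
      (fun t _ => (hder t).differentiableAt.differentiableWithinAt) fun t ht => ?_
    rw [interior_Icc] at ht
    rw [(hder t).deriv, ← inner_sub_left]
    have h1 := real_inner_le_norm (gradient F (x + t • h) - gradient F x) h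
    have h2 := hL (x + t • h) x
    rw [add_sub_cancel_left, norm_smul, Real.norm_of_nonneg ht.1.le] at h2
    nlinarith [mul_le_mul_of_nonneg_right h2 (norm_nonneg h)]
  have := hanti (Set.left_mem_Icc.2 zero_le_one) (Set.right_mem_Icc.2 zero_le_one) zero_le_one
  simp only [hφ, one_smul, zero_smul, add_zero] at this
  linarith

end Descent

/-- The standing assumptions on the finite sum. -/
structure IsSmoothSum (f : Fin n → EuclideanSpace ℝ (Fin d) → ℝ)
    (xstar : EuclideanSpace ℝ (Fin d)) (L σ : ℝ) : Prop where
  one_le : 1 ≤ n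
  L_pos : 0 < L
  differentiable : ∀ i, Differentiable ℝ (f i)
  lipschitz : ∀ x y, (∑ i, ‖gradient (f i) x - gradient (f i) y‖ ^ 2) / n ≤ L ^ 2 * ‖x - y‖ ^ 2
  variance : ∀ x, (∑ i, ‖gradient (f i) x - gradient (objective f) x‖ ^ 2) / n ≤ σ ^ 2
  isMin : ∀ x, objective f xstar ≤ objective f x

namespace IsSmoothSum

variable {f : Fin n → EuclideanSpace ℝ (Fin d) → ℝ} {xstar : EuclideanSpace ℝ (Fin d)} {L σ : ℝ}

lemma hasGradientAt (H : IsSmoothSum f xstar L σ) (x : EuclideanSpace ℝ (Fin d)) :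
    HasGradientAt (objective f) ((n : ℝ)⁻¹ • ∑ i, gradient (f i) x) x := by
  have h1 : ∀ i ∈ Finset.univ, HasFDerivAt (f i)
      (InnerProductSpace.toDual ℝ _ (gradient (f i) x)) x :=
    fun i _ => (H.differentiable i x).hasGradientAt.hasFDerivAt
  have h2 := (HasFDerivAt.fun_sum h1).const_mul (n : ℝ)⁻¹
  rw [hasGradientAt_iff_hasFDerivAt]
  have h3 : objective f = fun y => (n : ℝ)⁻¹ * ∑ i, f i y := by
    funext y
    simp [objective, div_eq_inv_mul]
  rw [h3]
  exact h2.congr_fderiv (by simp)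

lemma sum_gradient (H : IsSmoothSum f xstar L σ) (x : EuclideanSpace ℝ (Fin d)) :
    ∑ i, gradient (f i) x = (n : ℝ) • gradient (objective f) x := by
  have hn : (n : ℝ) ≠ 0 := by have := H.one_le; positivity
  rw [(H.hasGradientAt x).gradient, smul_smul, mul_inv_cancel₀ hn, one_smul]

lemma sum_gradient_sub (H : IsSmoothSum f xstar L σ) (x y : EuclideanSpace ℝ (Fin d)) :
    ∑ i, (gradient (f i) x - gradient (f i) y) =
      (n : ℝ) • (gradient (objective f) x - gradient (objective f) y) := by
  rw [Finset.sum_sub_distrib, H.sum_gradient, H.sum_gradient, smul_sub]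

/-- The squared norm of a mean is at most the mean of the squared norms. -/
lemma lipschitz_gradient (H : IsSmoothSum f xstar L σ) (x y : EuclideanSpace ℝ (Fin d)) :
    ‖gradient (objective f) x - gradient (objective f) y‖ ≤ L * ‖x - y‖ := by
  have hn : (0 : ℝ) < n := by have := H.one_le; positivity
  have h1 : ‖gradient (objective f) x - gradient (objective f) y‖ ^ 2 ≤ (L * ‖x - y‖) ^ 2 := by
    rw [mul_pow]
    refine le_trans ?_ (H.lipschitz x y)
    have h2 : (n : ℝ) * ‖gradient (objective f) x - gradient (objective f) y‖ ≤
        ∑ i, ‖gradient (f i) x - gradient (f i) y‖ := by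
      have := norm_sum_le Finset.univ fun i => gradient (f i) x - gradient (f i) y
      rwa [H.sum_gradient_sub, norm_smul, RCLike.norm_natCast] at this
    have h3 := sq_sum_le_card_mul_sum_sq (s := Finset.univ)
      (f := fun i => ‖gradient (f i) x - gradient (f i) y‖)
    rw [Finset.card_univ, Fintype.card_fin] at h3
    have h4 := pow_le_pow_left₀ (by positivity) h2 2
    rw [le_div_iff₀ hn]
    have h5 := h4.trans h3
    rw [mul_pow] at h5
    nlinarith
  exact le_of_sq_le_sq h1 (mul_nonneg H.L_pos.le (norm_nonneg _))

/-- Polarization turns `-η⟨∇F, v⟩` into `(η/2)(‖v - ∇F‖² - ‖v‖² - ‖∇F‖²)`. The curvature term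
`Lη²‖v‖²/2` uses up at most half of `-(η/2)‖v‖²`. -/
lemma descent_step (H : IsSmoothSum f xstar L σ) {η : ℝ} (hη : 0 < η) (hLη : L * η ≤ 1 / 2)
    (x v : EuclideanSpace ℝ (Fin d)) :
    objective f (x - η • v) + η / 2 * ‖gradient (objective f) x‖ ^ 2 + η / 4 * ‖v‖ ^ 2 ≤
      objective f x + η / 2 * ‖v - gradient (objective f) x‖ ^ 2 := by
  have h := le_add_inner_add_of_lipschitz_gradient
    (fun x => (H.hasGradientAt x).differentiableAt) H.lipschitz_gradient x (-(η • v))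
  rw [← sub_eq_add_neg, norm_neg, norm_smul, inner_neg_right, real_inner_smul_right,
    Real.norm_of_nonneg hη.le] at h
  rw [norm_sub_sq_real, real_inner_comm]
  have : L / 2 * (η * ‖v‖) ^ 2 ≤ η / 4 * ‖v‖ ^ 2 := by
    have := mul_le_mul_of_nonneg_right hLη (mul_nonneg hη.le (sq_nonneg ‖v‖))
    nlinarith
  nlinarith

end IsSmoothSum

/-- The optimality gap of an iterate. -/
def gap (f : Fin n → EuclideanSpace ℝ (Fin d) → ℝ) (xstar x : EuclideanSpace ℝ (Fin d)) : ℝ≥0∞ :=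
  ENNReal.ofReal (objective f x - objective f xstar)

/-- The squared norm of the gradient of the objective. -/
def gradSq (f : Fin n → EuclideanSpace ℝ (Fin d) → ℝ) (x : EuclideanSpace ℝ (Fin d)) : ℝ≥0∞ :=
  ENNReal.ofReal (‖gradient (objective f) x‖ ^ 2)

/-- The squared error of a gradient estimator `v` at `x`. -/
def errSq (f : Fin n → EuclideanSpace ℝ (Fin d) → ℝ) (x v : EuclideanSpace ℝ (Fin d)) : ℝ≥0∞ :=
  ENNReal.ofReal (‖v - gradient (objective f) x‖ ^ 2)

section InnerLoop

variable {f : Fin n → EuclideanSpace ℝ (Fin d) → ℝ} {xstar : EuclideanSpace ℝ (Fin d)} {L σ : ℝ}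

/-- The new iterate does not depend on the fresh sample, so this is the deterministic descent step.
-/
lemma expect_innerStep_gap_le (H : IsSmoothSum f xstar L σ) {η : ℝ} (hη : 0 < η)
    (hLη : L * η ≤ 1 / 2) (b : ℕ)
    (s : EuclideanSpace ℝ (Fin d) × EuclideanSpace ℝ (Fin d) × ℕ) :
    expect (innerStep f η b s) (fun t => gap f xstar t.1) +
        ENNReal.ofReal (η / 2) * gradSq f s.1 +
        ENNReal.ofReal (η / 4) * ENNReal.ofReal (‖s.2.1‖ ^ 2) ≤
      gap f xstar s.1 + ENNReal.ofReal (η / 2) * errSq f s.1 s.2.1 := by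
  rw [innerStep, expect_map]
  simp only [expect_const, gap, gradSq, errSq]
  have h1 := sub_nonneg.2 (H.isMin s.1)
  have h2 := sub_nonneg.2 (H.isMin (s.1 - η • s.2.1))
  rw [← ENNReal.ofReal_mul (by positivity), ← ENNReal.ofReal_mul (by positivity),
    ← ENNReal.ofReal_mul (by positivity), ← ENNReal.ofReal_add h2 (by positivity),
    ← ENNReal.ofReal_add (by positivity) (by positivity),
    ← ENNReal.ofReal_add h1 (by positivity)]
  apply ENNReal.ofReal_le_ofReal
  linarith [H.descent_step hη hLη s.1 s.2.1]

/-- The new error is the old one, a fixed offset, plus a centred sampling error, so the cross term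
vanishes. The variance of the gradient differences is at most their second moment, which is at most
`L²‖x' - x‖² = L²η²‖v‖²`; averaging over `b` samples divides it by `b`. -/
lemma expect_innerStep_errSq_le (H : IsSmoothSum f xstar L σ) (η : ℝ) {b : ℕ} (hb : 1 ≤ b)
    (hbn : b ≤ n) (s : EuclideanSpace ℝ (Fin d) × EuclideanSpace ℝ (Fin d) × ℕ) :
    expect (innerStep f η b s) (fun t => errSq f t.1 t.2.1) ≤
      errSq f s.1 s.2.1 +
        ENNReal.ofReal (L ^ 2 * η ^ 2 / b) * ENNReal.ofReal (‖s.2.1‖ ^ 2) := by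
  rw [innerStep, expect_map]
  simp only [errSq]
  set x' := s.1 - η • s.2.1 with hx'
  have h1 := expect_sampleSubset_norm_sq_le hb hbn
    (fun i => gradient (f i) x' - gradient (f i) s.1)
    (gradient (objective f) x' - gradient (objective f) s.1)
    (s.2.1 - gradient (objective f) s.1) (H.sum_gradient_sub _ _)
  rw [← ENNReal.ofReal_mul (by positivity), ← ENNReal.ofReal_add (by positivity) (by positivity)]
  have hb0 : (0 : ℝ) < b := by exact_mod_cast hb
  refine le_trans (le_of_eq ?_) (h1.trans (ENNReal.ofReal_le_ofReal ?_))
  · congr 1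
    funext I
    congr 3
    abel
  · gcongr
    rw [div_mul_eq_mul_div, div_le_div_iff_of_pos_right hb0]
    have h2 := sum_norm_sub_mean_sq_le _ _ (H.sum_gradient_sub x' s.1)
    have h3 := H.lipschitz x' s.1
    have h4 : x' - s.1 = -(η • s.2.1) := by rw [hx']; abel
    rw [h4, norm_neg, norm_smul, mul_pow, Real.norm_eq_abs, sq_abs, ← mul_assoc] at h3
    refine le_trans ?_ h3
    gcongr

lemma expect_innerLoop_queries {η : ℝ} {b : ℕ} (hbn : b ≤ n) (k : ℕ)
    (s : EuclideanSpace ℝ (Fin d) × EuclideanSpace ℝ (Fin d) × ℕ) :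
    expect (innerLoop f η b k s) (fun t => (t.2.2 : ℝ≥0∞)) = s.2.2 + 2 * b * k := by
  induction k with
  | zero => simp [innerLoop, expect_pure]
  | succ k ih =>
    have h : ∀ t, expect (innerStep f η b t) (fun t => (t.2.2 : ℝ≥0∞)) = t.2.2 + 2 * b := by
      intro t
      rw [innerStep, expect_map, expect_congr_of_mem_support (h := fun _ => (t.2.2 + 2 * b : ℝ≥0∞)),
        expect_const]
      intro I hI
      rw [card_of_mem_support_sampleSubset hbn hI]
      push_cast
      rfl
    rw [innerLoop, expect_bind]
    simp_rw [h]
    rw [expect_add, ih, expect_const]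
    push_cast
    ring

lemma expect_innerLoop_le (H : IsSmoothSum f xstar L σ) {η : ℝ} (hη : 0 < η)
    (hLη : L * η ≤ 1 / 2) {b : ℕ} (hb : 1 ≤ b) (hbn : b ≤ n) {r : NNReal} (hr : 0 < r)
    (hrc : r * (L ^ 2 * η ^ 2 / b) ≤ 1 / 4)
    (s : EuclideanSpace ℝ (Fin d) × EuclideanSpace ℝ (Fin d) × ℕ) :
    expect (geometricLaw r) (fun k => expect (innerLoop f η b k s)
        (fun t => gap f xstar t.1 + ENNReal.ofReal (r * η / 2) * gradSq f t.1)) ≤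
      gap f xstar s.1 + ENNReal.ofReal (r * η / 2) * errSq f s.1 s.2.1 := by
  have key := expect_geometricLaw_le r hr hη (c := L ^ 2 * η ^ 2 / b) (by positivity) hrc
    (fun k => expect (innerLoop f η b k s) fun t => gap f xstar t.1)
    (fun k => expect (innerLoop f η b k s) fun t => gradSq f t.1)
    (fun k => expect (innerLoop f η b k s) fun t => ENNReal.ofReal (‖t.2.1‖ ^ 2))
    (fun k => expect (innerLoop f η b k s) fun t => errSq f t.1 t.2.1)
    (by simp [innerLoop, expect_pure, gap]) (by simp [innerLoop, expect_pure, errSq])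
    (fun k => by
      rw [innerLoop, expect_bind, ← expect_const_mul, ← expect_const_mul, ← expect_const_mul,
        ← expect_add, ← expect_add, ← expect_add]
      exact expect_mono fun t => expect_innerStep_gap_le H hη hLη b t)
    (fun k => by
      rw [innerLoop, expect_bind, ← expect_const_mul, ← expect_add]
      exact expect_mono fun t => expect_innerStep_errSq_le H η hb hbn t)
  simp only [expect_add, expect_const_mul] at key ⊢
  simpa only [innerLoop, expect_pure] using key

end InnerLoop

section Epoch

variable {f : Fin n → EuclideanSpace ℝ (Fin d) → ℝ} {xstar : EuclideanSpace ℝ (Fin d)} {L σ : ℝ}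

lemma expect_bigBatch_errSq_le (H : IsSmoothSum f xstar L σ) {B : ℕ} (hB : 1 ≤ B) (hBn : B ≤ n)
    (x : EuclideanSpace ℝ (Fin d)) :
    expect (sampleSubset n B) (fun J => errSq f x ((B : ℝ)⁻¹ • ∑ i ∈ J, gradient (f i) x)) ≤
      ENNReal.ofReal (if B < n then σ ^ 2 / B else 0) := by
  split_ifs with h
  · have h1 := expect_sampleSubset_norm_sq_le hB hBn (fun i => gradient (f i) x)
      (gradient (objective f) x) 0 (H.sum_gradient x)
    simp only [add_zero, norm_zero, ne_eq, OfNat.ofNat_ne_zero, not_false_eq_true, zero_pow,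
      zero_add] at h1
    refine h1.trans (ENNReal.ofReal_le_ofReal ?_)
    gcongr
    exact H.variance x
  · obtain rfl : B = n := by omega
    rw [ENNReal.ofReal_zero]
    exact (expect_sampleSubset_self_norm_sq hB _ _ (H.sum_gradient x)).le

lemma expect_epoch_le (H : IsSmoothSum f xstar L σ) (P : Params) (j : ℕ) (hη : 0 < P.η j)
    (hLη : L * P.η j ≤ 1 / 2) (hb : 1 ≤ P.b j) (hbn : P.b j ≤ n) (hB : 1 ≤ P.B j)
    (hBn : P.B j ≤ n) (hm : 1 ≤ P.m j)
    (hrc : (P.m j : ℝ) / P.b j * (L ^ 2 * P.η j ^ 2 / P.b j) ≤ 1 / 4)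
    (s : EuclideanSpace ℝ (Fin d) × ℕ) :
    expect (epoch P f j s) (fun t => gap f xstar t.1 +
        ENNReal.ofReal ((P.m j : ℝ) / P.b j * P.η j / 2) * gradSq f t.1) ≤
      gap f xstar s.1 + ENNReal.ofReal ((P.m j : ℝ) / P.b j * P.η j / 2) *
        ENNReal.ofReal (if P.B j < n then σ ^ 2 / P.B j else 0) := by
  have hb0 : 0 < P.b j := hb
  have hm0 : 0 < P.m j := hm
  set r : NNReal := (P.m j : NNReal) / (P.b j : NNReal) with hr
  have hrc' : (r : ℝ) = (P.m j : ℝ) / P.b j := by simp [hr]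
  have hr0 : 0 < r := by rw [hr]; positivity
  rw [← hrc'] at hrc ⊢
  rw [epoch, expect_bind]
  refine le_trans ?_ (add_le_add_right (mul_le_mul_right
    (expect_bigBatch_errSq_le H hB hBn s.1) _) _)
  rw [← expect_const_mul, ← expect_const (sampleSubset n (P.B j)) (gap f xstar s.1), ← expect_add]
  refine expect_mono fun J => ?_
  rw [expect_bind]
  simp only [expect_map]
  exact expect_innerLoop_le H hη hLη hb hbn hr0 hrc _

/-- The mini-batch size cancels: each of the `m / b` expected steps costs `2 b` queries. -/
lemma expect_epoch_queries (P : Params) (j : ℕ) (hb : 1 ≤ P.b j) (hbn : P.b j ≤ n)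
    (hBn : P.B j ≤ n) (s : EuclideanSpace ℝ (Fin d) × ℕ) :
    expect (epoch P f j s) (fun t => (t.2 : ℝ≥0∞)) = s.2 + (P.B j + 2 * P.m j : ℕ) := by
  have hb0 : (P.b j : ℝ≥0∞) ≠ 0 := by
    have : 0 < P.b j := hb
    exact_mod_cast this.ne'
  rw [epoch, expect_bind, expect_congr_of_mem_support
    (h := fun _ => (s.2 + (P.B j + 2 * P.m j : ℕ) : ℝ≥0∞)), expect_const]
  intro J hJ
  rw [expect_bind]
  simp only [expect_map, expect_innerLoop_queries hbn, expect_add, expect_const,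
    expect_const_mul, expect_geometricLaw_natCast, card_of_mem_support_sampleSubset hBn hJ]
  have hbN : (P.b j : NNReal) ≠ 0 := by exact_mod_cast hb0
  rw [ENNReal.coe_div hbN]
  simp only [ENNReal.coe_natCast]
  rw [mul_assoc, ENNReal.mul_div_cancel hb0 (ENNReal.natCast_ne_top _)]
  push_cast
  ring

end Epoch

end

/-! ### Q-Geom-SARAH: the recursion over epochs, query counts and the output index. -/

section

variable {d n : ℕ}

/-- Q-Geom-SARAH with arbitrary weights of the output index. -/
def qGeomSarahWith (n : ℕ) (L : ℝ) (b : ℕ → ℕ) (w : ℕ → ℝ) : Params :=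
  { qGeomSarah n L b with w := w }

/-- The root `√(m j)` of the big-batch size. -/
def rootBatch (n j : ℕ) : ℝ := √((min (j ^ 2) n : ℕ) : ℝ)

/-- The contribution of the big-batch variance in epoch `j` to the optimality gap. -/
def batchNoise (n : ℕ) (L σ : ℝ) (j : ℕ) : ℝ :=
  if j ^ 2 < n then σ ^ 2 / (4 * L * j) else 0

lemma rootBatch_sq (n j : ℕ) : rootBatch n j ^ 2 = ((min (j ^ 2) n : ℕ) : ℝ) :=
  Real.sq_sqrt (Nat.cast_nonneg _)

lemma rootBatch_nonneg (n j : ℕ) : 0 ≤ rootBatch n j := Real.sqrt_nonneg _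

lemma one_le_rootBatch {n j : ℕ} (hn : 1 ≤ n) (hj : 1 ≤ j) : 1 ≤ rootBatch n j := by
  rw [rootBatch, Real.one_le_sqrt]
  exact_mod_cast le_min (Nat.one_le_pow 2 j hj) hn

lemma rootBatch_of_le {n j : ℕ} (h : j ^ 2 ≤ n) : rootBatch n j = j := by
  rw [rootBatch, min_eq_left h, Nat.cast_pow, Real.sqrt_sq (Nat.cast_nonneg _)]

lemma rootBatch_of_ge {n j : ℕ} (h : n ≤ j ^ 2) : rootBatch n j = √n := by
  rw [rootBatch, min_eq_right h]

lemma rootBatch_eq_min (n j : ℕ) : rootBatch n j = min (j : ℝ) (√n) := by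
  rcases le_total (j ^ 2) n with h | h
  · rw [rootBatch_of_le h, min_eq_left]
    exact Real.le_sqrt_of_sq_le (by exact_mod_cast h)
  · rw [rootBatch_of_ge h, min_eq_right]
    exact Real.sqrt_le_iff.2 ⟨Nat.cast_nonneg _, by exact_mod_cast h⟩

lemma rootBatch_mono (n : ℕ) {i j : ℕ} (h : i ≤ j) : rootBatch n i ≤ rootBatch n j := by
  rw [rootBatch_eq_min, rootBatch_eq_min]
  exact min_le_min_right _ (by exact_mod_cast h)

section Run

variable {f : Fin n → EuclideanSpace ℝ (Fin d) → ℝ} {x₀ xstar : EuclideanSpace ℝ (Fin d)}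
  {L σ : ℝ} {b : ℕ → ℕ} {w : ℕ → ℝ}

/-- Mini-batch sizes admissible for Q-Geom-SARAH. -/
def AdmissibleBatch (n : ℕ) (b : ℕ → ℕ) : Prop :=
  ∀ j, 1 ≤ j → 1 ≤ b j ∧ (b j : ℝ) ≤ rootBatch n j

lemma AdmissibleBatch.le (hb : AdmissibleBatch n b) {j : ℕ} (hj : 1 ≤ j) : b j ≤ n := by
  have h1 := (hb j hj).2
  have h2 : (1 : ℝ) ≤ b j := by exact_mod_cast (hb j hj).1
  have h3 := rootBatch_sq n j
  have h4 : (b j : ℝ) ≤ ((min (j ^ 2) n : ℕ) : ℝ) := by nlinarith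
  exact (Nat.cast_le.1 h4).trans (min_le_right _ _)

/-- For `η = b / (2L√m)` and `r = m / b`, the error condition reads `r L²η²/b = 1/4`, and the gain
`rη/2 = √m/(4L)` no longer involves `b`. The bound `b ≤ √m` is what gives `Lη ≤ 1/2`. The big-batch
variance `σ²/m` times the gain is `batchNoise`. -/
lemma expect_run_succ_le (H : IsSmoothSum f xstar L σ) (hb : AdmissibleBatch n b) (j : ℕ) :
    expect (run (qGeomSarahWith n L b w) f x₀ (j + 1)) (fun t => gap f xstar t.1) +
        ENNReal.ofReal (rootBatch n (j + 1) / (4 * L)) *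
          expect (run (qGeomSarahWith n L b w) f x₀ (j + 1)) (fun t => gradSq f t.1) ≤
      expect (run (qGeomSarahWith n L b w) f x₀ j) (fun t => gap f xstar t.1) +
        ENNReal.ofReal (batchNoise n L σ (j + 1)) := by
  have hn := H.one_le
  have hL := H.L_pos
  obtain ⟨hb1, hb2⟩ := hb (j + 1) (by omega)
  have hs := one_le_rootBatch (j := j + 1) hn (by omega)
  have hm1 : 1 ≤ min ((j + 1) ^ 2) n := le_min (Nat.one_le_pow _ _ (by omega)) hn
  have hm := rootBatch_sq n (j + 1)
  set P := qGeomSarahWith n L b w with hP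
  have hPη : P.η (j + 1) = b (j + 1) / (2 * L * rootBatch n (j + 1)) := rfl
  have hPb : P.b (j + 1) = b (j + 1) := rfl
  have hPm : P.m (j + 1) = min ((j + 1) ^ 2) n := rfl
  have hPB : P.B (j + 1) = min ((j + 1) ^ 2) n := rfl
  have hbpos : (0 : ℝ) < b (j + 1) := by exact_mod_cast hb1
  have hspos : 0 < rootBatch n (j + 1) := by linarith
  have hscale : ((P.m (j + 1) : ℕ) : ℝ) / P.b (j + 1) * P.η (j + 1) / 2 =
      rootBatch n (j + 1) / (4 * L) := by
    rw [hPη, hPb, hPm, ← hm]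
    field_simp
    norm_num
  have key := expect_epoch_le (d := d) H P (j + 1) (by rw [hPη]; positivity)
    (by
      rw [hPη, show L * ((b (j + 1) : ℝ) / (2 * L * rootBatch n (j + 1))) =
        b (j + 1) / rootBatch n (j + 1) * (1 / 2) by field_simp]
      have : (b (j + 1) : ℝ) / rootBatch n (j + 1) ≤ 1 := (div_le_one hspos).2 hb2
      linarith)
    hb1 (hb.le (by omega)) hm1 (min_le_right _ _) hm1
    (by
      rw [hPη, hPb, hPm, ← hm]
      apply le_of_eq
      field_simp
      norm_num)
  rw [hscale] at key
  rw [← expect_const_mul, ← expect_add, run, expect_bind]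
  refine (expect_mono key).trans (le_of_eq ?_)
  rw [expect_add, expect_const, ← ENNReal.ofReal_mul (by positivity), batchNoise, hPB]
  congr 2
  by_cases h : (j + 1) ^ 2 < n
  · rw [min_eq_left h.le, if_pos h, if_pos h, rootBatch_of_le h.le]
    push_cast
    field_simp
  · rw [min_eq_right (not_lt.1 h), if_neg h, if_neg (lt_irrefl _), mul_zero]

lemma expect_run_queries (hb : AdmissibleBatch n b) (j : ℕ) :
    expect (run (qGeomSarahWith n L b w) f x₀ j) (fun t => (t.2 : ℝ≥0∞)) =
      ((∑ i ∈ Finset.range j, 3 * min ((i + 1) ^ 2) n : ℕ) : ℝ≥0∞) := by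
  induction j with
  | zero => simp [run, expect_pure]
  | succ j ih =>
    have h := expect_epoch_queries (f := f) (qGeomSarahWith n L b w) (j + 1)
      (hb (j + 1) (by omega)).1 (hb.le (by omega)) (min_le_right _ _)
    have hq : (qGeomSarahWith n L b w).B (j + 1) + 2 * (qGeomSarahWith n L b w).m (j + 1) =
        3 * min ((j + 1) ^ 2) n := by
      change min ((j + 1) ^ 2) n + 2 * min ((j + 1) ^ 2) n = _
      ring
    rw [run, expect_bind]
    simp_rw [h, hq]
    rw [expect_add, ih, expect_const, Finset.sum_range_succ, ← Nat.cast_add]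

lemma numEpochs_qGeomSarahWith (T : ℕ) : numEpochs (qGeomSarahWith n L b w) T = 2 * T := by
  have : (1 + (qGeomSarahWith n L b w).δ) * (T : ℝ) = ((2 * T : ℕ) : ℝ) := by
    change (1 + (1 : ℝ)) * T = _
    push_cast; ring
  rw [numEpochs, this, Nat.ceil_natCast]

/-- The `2T` epochs cost `3 m j` each, where `m j` is at most `(2T)²` and at most `n`. Monotonicity
in `T` lets any accurate `T₀` bound the cost at the least one. -/
lemma expectedQueries_le (hb : AdmissibleBatch n b) {T T₀ : ℕ} (hT : T ≤ T₀) :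
    expectedQueries (qGeomSarahWith n L b w) f x₀ T ≤
      ENNReal.ofReal (min (24 * (T₀ : ℝ) ^ 3) (6 * n * T₀)) := by
  rw [expectedQueries, numEpochs_qGeomSarahWith, expect_run_queries hb]
  have h1 : ∑ i ∈ Finset.range (2 * T), 3 * min ((i + 1) ^ 2) n ≤ 24 * T₀ ^ 3 := by
    calc ∑ i ∈ Finset.range (2 * T), 3 * min ((i + 1) ^ 2) n
        ≤ ∑ i ∈ Finset.range (2 * T), 3 * (2 * T) ^ 2 := by
          refine Finset.sum_le_sum fun i hi => ?_
          have : i + 1 ≤ 2 * T := by have := Finset.mem_range.1 hi; omega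
          exact Nat.mul_le_mul_left _ ((min_le_left _ _).trans (Nat.pow_le_pow_left this 2))
      _ = 24 * T ^ 3 := by simp; ring
      _ ≤ _ := Nat.mul_le_mul_left _ (Nat.pow_le_pow_left hT 3)
  have h2 : ∑ i ∈ Finset.range (2 * T), 3 * min ((i + 1) ^ 2) n ≤ 6 * n * T₀ := by
    calc ∑ i ∈ Finset.range (2 * T), 3 * min ((i + 1) ^ 2) n
        ≤ ∑ i ∈ Finset.range (2 * T), 3 * n :=
          Finset.sum_le_sum fun i _ => Nat.mul_le_mul_left _ (min_le_right _ _)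
      _ = 6 * n * T := by simp; ring
      _ ≤ _ := Nat.mul_le_mul_left _ hT
  rw [← ENNReal.ofReal_natCast]
  refine ENNReal.ofReal_le_ofReal (le_min ?_ ?_)
  · exact_mod_cast h1
  · exact_mod_cast h2

lemma complexityOf_le (hb : AdmissibleBatch n b) {S : Set ℕ} {T₀ : ℕ} (hT : T₀ ∈ S) :
    complexityOf (qGeomSarahWith n L b w) f x₀ S ≤
      ENNReal.ofReal (min (24 * (T₀ : ℝ) ^ 3) (6 * n * T₀)) := by
  rw [complexityOf, if_pos ⟨T₀, hT⟩]
  exact expectedQueries_le hb (Nat.sInf_le hT)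

lemma expect_output (P : Params) (T : ℕ) (g : EuclideanSpace ℝ (Fin d) → ℝ≥0∞) :
    expect (output P f x₀ T) g =
      expect (outputIndex P T) fun j => expect (run P f x₀ j) fun t => g t.1 := by
  rw [output, expect_bind]
  simp only [expect_map]

/-- Only the support matters. It lies in `[T, ∞)` for all weights, including the placeholder law at
`T`. -/
lemma expect_outputIndex_le (T : ℕ) {v : ℕ → ℝ≥0∞} {c : ℝ≥0∞} (hv : ∀ j ≥ T, v j ≤ c)
    (P : Params) : expect (outputIndex P T) v ≤ c := by
  have h : ∀ j ∈ (outputIndex P T).support, T ≤ j := by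
    intro j hj
    unfold outputIndex at hj
    split_ifs at hj with hw
    · rw [PMF.mem_support_normalize_iff, tailWeight] at hj
      by_contra hlt
      exact hj (if_neg fun hm => hlt (Finset.mem_Icc.1 hm).1)
    · rw [PMF.mem_support_pure_iff] at hj
      exact hj.ge
  rw [expect_congr_of_mem_support (h := fun j => if T ≤ j then v j else 0)
    (fun j hj => by rw [if_pos (h j hj)]), ← expect_const (outputIndex P T) c]
  refine expect_mono fun j => ?_
  split_ifs with hj
  exacts [hv j hj, zero_le]

lemma tsum_tailWeight_mul (P : Params) (T : ℕ) (v : ℕ → ℝ≥0∞) :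
    ∑' j, tailWeight P T j * v j =
      ∑ j ∈ Finset.Icc T (numEpochs P T), ENNReal.ofReal (P.w j) * v j := by
  rw [tsum_eq_sum (s := Finset.Icc T (numEpochs P T))]
  · exact Finset.sum_congr rfl fun j hj => by rw [tailWeight, if_pos hj]
  · intro j hj
    rw [tailWeight, if_neg hj, zero_mul]

lemma expect_outputIndex_le_of_sum_le {P : Params} {T : ℕ} (hT : T ≤ numEpochs P T)
    (hw : 0 < P.w T) (hw' : ∀ j, 0 ≤ P.w j) {v : ℕ → ℝ} (hv : ∀ j, 0 ≤ v j) {c : ℝ}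
    (hc : 0 ≤ c)
    (h : ∑ j ∈ Finset.Icc T (numEpochs P T), P.w j * v j ≤
      c * ∑ j ∈ Finset.Icc T (numEpochs P T), P.w j) :
    expect (outputIndex P T) (fun j => ENNReal.ofReal (v j)) ≤ ENNReal.ofReal c := by
  have hsum : ∑' j, tailWeight P T j =
      ENNReal.ofReal (∑ j ∈ Finset.Icc T (numEpochs P T), P.w j) := by
    have := tsum_tailWeight_mul P T fun _ => 1
    simp only [mul_one] at this
    rw [this, ENNReal.ofReal_sum_of_nonneg fun j _ => hw' j]
  have hpos : 0 < ∑ j ∈ Finset.Icc T (numEpochs P T), P.w j :=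
    Finset.sum_pos' (fun j _ => hw' j) ⟨T, Finset.mem_Icc.2 ⟨le_rfl, hT⟩, hw⟩
  have hnorm : ∑' j, tailWeight P T j ≠ 0 ∧ ∑' j, tailWeight P T j ≠ ∞ := by
    rw [hsum]
    exact ⟨by simpa using hpos, ENNReal.ofReal_ne_top⟩
  rw [outputIndex, dif_pos hnorm]
  unfold expect
  simp only [PMF.normalize_apply]
  simp_rw [mul_right_comm _ (∑' j, tailWeight P T j)⁻¹]
  rw [ENNReal.tsum_mul_right, tsum_tailWeight_mul, ← div_eq_mul_inv]
  refine ENNReal.div_le_of_le_mul ?_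
  rw [hsum, ← ENNReal.ofReal_mul hc]
  simp_rw [← ENNReal.ofReal_mul (hw' _)]
  rw [← ENNReal.ofReal_sum_of_nonneg fun j _ => mul_nonneg (hw' j) (hv j)]
  exact ENNReal.ofReal_le_ofReal h

/-- The one-epoch recursion for the expected gaps `A j` and squared gradient norms `G j`. -/
structure GapRecursion (n : ℕ) (L σ : ℝ) (A G : ℕ → ℝ) : Prop where
  one_le : 1 ≤ n
  L_pos : 0 < L
  A_nonneg : ∀ j, 0 ≤ A j
  G_nonneg : ∀ j, 0 ≤ G j
  step : ∀ j, A (j + 1) + rootBatch n (j + 1) / (4 * L) * G (j + 1) ≤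
    A j + batchNoise n L σ (j + 1)

/-- From here on the algorithm enters only through two real sequences. Finiteness of the expected
gaps follows by induction, that of the gradients from their positive coefficient. -/
lemma exists_gapRecursion (H : IsSmoothSum f xstar L σ) (hb : AdmissibleBatch n b) (w : ℕ → ℝ)
    (x₀ : EuclideanSpace ℝ (Fin d)) :
    ∃ A G : ℕ → ℝ, GapRecursion n L σ A G ∧
      A 0 = objective f x₀ - objective f xstar ∧
      (∀ j, expect (run (qGeomSarahWith n L b w) f x₀ j) (fun t => gap f xstar t.1) =
        ENNReal.ofReal (A j)) ∧
      (∀ j, expect (run (qGeomSarahWith n L b w) f x₀ j) (fun t => gradSq f t.1) =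
        ENNReal.ofReal (G j)) := by
  have hL := H.L_pos
  set A' : ℕ → ℝ≥0∞ := fun j =>
    expect (run (qGeomSarahWith n L b w) f x₀ j) (fun t => gap f xstar t.1) with hA'
  set G' : ℕ → ℝ≥0∞ := fun j =>
    expect (run (qGeomSarahWith n L b w) f x₀ j) (fun t => gradSq f t.1) with hG'
  have hstep : ∀ j, A' (j + 1) + ENNReal.ofReal (rootBatch n (j + 1) / (4 * L)) * G' (j + 1) ≤
      A' j + ENNReal.ofReal (batchNoise n L σ (j + 1)) := fun j => expect_run_succ_le H hb j
  have hA0 : A' 0 = ENNReal.ofReal (objective f x₀ - objective f xstar) := by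
    simp [hA', run, expect_pure, gap]
  have hspos : ∀ j, 0 < rootBatch n (j + 1) / (4 * L) := fun j =>
    div_pos (by linarith [one_le_rootBatch (j := j + 1) H.one_le (by omega)]) (by linarith)
  have hA : ∀ j, A' j ≠ ∞ := by
    intro j
    induction j with
    | zero => rw [hA0]; exact ENNReal.ofReal_ne_top
    | succ j ih =>
      exact ne_top_of_le_ne_top (ENNReal.add_ne_top.2 ⟨ih, ENNReal.ofReal_ne_top⟩)
        (le_self_add.trans (hstep j))
  have hG : ∀ j, G' j ≠ ∞ := by
    intro j
    cases j with
    | zero => simp [hG', run, expect_pure, gradSq]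
    | succ j =>
      intro hG
      have := ne_top_of_le_ne_top (ENNReal.add_ne_top.2 ⟨hA j, ENNReal.ofReal_ne_top⟩)
        (le_add_self.trans (hstep j))
      rw [hG, ENNReal.mul_top (by simpa using hspos j)] at this
      exact this rfl
  refine ⟨fun j => (A' j).toReal, fun j => (G' j).toReal, ⟨H.one_le, hL,
    fun j => ENNReal.toReal_nonneg, fun j => ENNReal.toReal_nonneg, fun j => ?_⟩, ?_,
    fun j => (ENNReal.ofReal_toReal (hA j)).symm, fun j => (ENNReal.ofReal_toReal (hG j)).symm⟩
  · have hν : 0 ≤ batchNoise n L σ (j + 1) := by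
      unfold batchNoise
      split_ifs <;> positivity
    have := ENNReal.toReal_mono (ENNReal.add_ne_top.2 ⟨hA j, ENNReal.ofReal_ne_top⟩) (hstep j)
    rwa [ENNReal.toReal_add (hA _) (ENNReal.mul_ne_top ENNReal.ofReal_ne_top (hG _)),
      ENNReal.toReal_mul, ENNReal.toReal_add (hA j) ENNReal.ofReal_ne_top,
      ENNReal.toReal_ofReal (hspos j).le, ENNReal.toReal_ofReal hν] at this
  · change (A' 0).toReal = _
    rw [hA0, ENNReal.toReal_ofReal (sub_nonneg.2 (H.isMin x₀))]

end Run

end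

/-! ### Consequences of the recursion for real sequences. -/

section

variable {n : ℕ} {L σ : ℝ}

/-- The noise is dominated by a harmonic sum of length `n`, and `1 + log n ≤ 4 log n` for `n ≥ 2`.
For `n = 1` there is no noise, matching `log 1 = 0`. -/
lemma sum_batchNoise_le (hn : 1 ≤ n) (hL : 0 < L) (J : ℕ) :
    ∑ j ∈ Finset.range J, batchNoise n L σ (j + 1) ≤ σ ^ 2 / L * Real.log n := by
  obtain rfl | hn2 : n = 1 ∨ 2 ≤ n := by omega
  · have h : ∀ j, batchNoise 1 L σ (j + 1) = 0 := fun j => by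
      rw [batchNoise, if_neg]
      have := Nat.one_le_pow 2 (j + 1) (by omega)
      omega
    simp [h]
  · have h1 : ∑ j ∈ Finset.range J, batchNoise n L σ (j + 1) ≤
        σ ^ 2 / (4 * L) * ∑ j ∈ Finset.range n, ((j + 1 : ℕ) : ℝ)⁻¹ := by
      simp only [batchNoise]
      rw [← Finset.sum_filter, Finset.mul_sum]
      have h2 : ∀ j : ℕ, σ ^ 2 / (4 * L * ((j + 1 : ℕ) : ℝ)) =
          σ ^ 2 / (4 * L) * ((j + 1 : ℕ) : ℝ)⁻¹ := fun j => by field_simp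
      simp_rw [h2]
      refine Finset.sum_le_sum_of_subset_of_nonneg ?_ fun j _ _ => by positivity
      intro j hj
      rw [Finset.mem_filter] at hj
      rw [Finset.mem_range]
      nlinarith [hj.2]
    have h3 := harmonic_le_one_add_log n
    have h4 : ((harmonic n : ℚ) : ℝ) = ∑ j ∈ Finset.range n, ((j + 1 : ℕ) : ℝ)⁻¹ := by
      simp [harmonic]
    rw [h4] at h3
    have h5 : Real.log 2 ≤ Real.log n := Real.log_le_log (by norm_num) (by exact_mod_cast hn2)
    have h6 := Real.log_two_gt_d9
    calc _ ≤ _ := h1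
      _ ≤ σ ^ 2 / (4 * L) * (1 + Real.log n) := by gcongr
      _ ≤ σ ^ 2 / (4 * L) * (4 * Real.log n) := by gcongr; linarith
      _ = _ := by field_simp

namespace GapRecursion

variable {A G : ℕ → ℝ} {Δ μ : ℝ}

lemma rootBatch_pos (R : GapRecursion n L σ A G) (j : ℕ) : 0 < rootBatch n (j + 1) := by
  linarith [one_le_rootBatch (j := j + 1) R.one_le (by omega)]

/-- The telescoped recursion. -/
lemma add_sum_le (R : GapRecursion n L σ A G) (hΔ : Δ = A 0 + σ ^ 2 / L * Real.log n) (J : ℕ) :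
    A J + ∑ j ∈ Finset.range J, rootBatch n (j + 1) / (4 * L) * G (j + 1) ≤ Δ := by
  have h : A J + ∑ j ∈ Finset.range J, rootBatch n (j + 1) / (4 * L) * G (j + 1) ≤
      A 0 + ∑ j ∈ Finset.range J, batchNoise n L σ (j + 1) := by
    induction J with
    | zero => simp
    | succ J ih =>
      rw [Finset.sum_range_succ, Finset.sum_range_succ]
      linarith [R.step J]
  have := sum_batchNoise_le (σ := σ) R.one_le R.L_pos J
  linarith

lemma A_le (R : GapRecursion n L σ A G) (hΔ : Δ = A 0 + σ ^ 2 / L * Real.log n) (J : ℕ) :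
    A J ≤ Δ := by
  have h := R.add_sum_le hΔ J
  have : 0 ≤ ∑ j ∈ Finset.range J, rootBatch n (j + 1) / (4 * L) * G (j + 1) :=
    Finset.sum_nonneg fun j _ => mul_nonneg
      (div_nonneg (rootBatch_nonneg _ _) (by linarith [R.L_pos])) (R.G_nonneg _)
  linarith

lemma sum_Icc_le (R : GapRecursion n L σ A G) (hΔ : Δ = A 0 + σ ^ 2 / L * Real.log n)
    {T : ℕ} (hT : 1 ≤ T) (K : ℕ) :
    ∑ j ∈ Finset.Icc T K, rootBatch n j / (2 * L) * G j ≤ 2 * Δ := by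
  have hL := R.L_pos
  have h := R.add_sum_le hΔ K
  have hA := R.A_nonneg K
  have h1 : ∑ j ∈ Finset.Icc T K, rootBatch n j / (4 * L) * G j ≤
      ∑ j ∈ Finset.range K, rootBatch n (j + 1) / (4 * L) * G (j + 1) := by
    rw [Finset.range_eq_Ico, Finset.sum_Ico_add' (fun j => rootBatch n j / (4 * L) * G j)]
    refine Finset.sum_le_sum_of_subset_of_nonneg (fun j hj => ?_) fun j _ _ =>
      mul_nonneg (div_nonneg (rootBatch_nonneg _ _) (by linarith)) (R.G_nonneg _)
    rw [Finset.mem_Icc] at hj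
    rw [Finset.mem_Ico]
    omega
  have h2 : ∑ j ∈ Finset.Icc T K, rootBatch n j / (2 * L) * G j =
      2 * ∑ j ∈ Finset.Icc T K, rootBatch n j / (4 * L) * G j := by
    rw [Finset.mul_sum]
    exact Finset.sum_congr rfl fun j _ => by field_simp; ring
  rw [h2]
  linarith

/-- The output of a long enough run of Q-Geom-SARAH for a general objective. -/
lemma sum_Icc_le_mul_sum (R : GapRecursion n L σ A G) (hΔ : Δ = A 0 + σ ^ 2 / L * Real.log n)
    {c : ℝ} (hc : 0 ≤ c) {T : ℕ} (hT : 1 ≤ T) (h : 4 * L * Δ ≤ c * (T * rootBatch n T)) :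
    ∑ j ∈ Finset.Icc T (2 * T), rootBatch n j / (2 * L) * G j ≤
      c * ∑ j ∈ Finset.Icc T (2 * T), rootBatch n j / (2 * L) := by
  have hL := R.L_pos
  refine (R.sum_Icc_le hΔ hT _).trans ?_
  -- The window has `T + 1` indices, and the weights `√(m j)/(2L)` increase with `j`.
  have h1 : (T : ℝ) * (rootBatch n T / (2 * L)) ≤
      ∑ j ∈ Finset.Icc T (2 * T), rootBatch n j / (2 * L) := by
    have h2 := Finset.card_nsmul_le_sum (Finset.Icc T (2 * T))
      (fun j => rootBatch n j / (2 * L)) (rootBatch n T / (2 * L)) fun j hj => by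
        have := rootBatch_mono n (Finset.mem_Icc.1 hj).1
        gcongr
    rw [Nat.card_Icc, nsmul_eq_mul] at h2
    refine le_trans (mul_le_mul_of_nonneg_right ?_
      (div_nonneg (rootBatch_nonneg _ _) (by linarith))) h2
    exact_mod_cast (by omega : T ≤ 2 * T + 1 - T)
  refine le_trans ?_ (mul_le_mul_of_nonneg_left h1 hc)
  have h3 : c * (T * (rootBatch n T / (2 * L))) = c * (T * rootBatch n T) / (2 * L) := by ring
  rw [h3, le_div_iff₀ (by positivity)]
  linarith

/-- One epoch turns a bound on the gap before it into a bound on the gradient after it. The factor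
`4L/√m` improves on the `2L` of smoothness for large `m`; this puts `√n` under the logarithm in the
full-batch bound. -/
lemma G_succ_le (R : GapRecursion n L σ A G) (j : ℕ) :
    G (j + 1) ≤ 4 * L / rootBatch n (j + 1) * (A j + batchNoise n L σ (j + 1)) := by
  have hL := R.L_pos
  have hs := R.rootBatch_pos j
  have h := R.step j
  have hA := R.A_nonneg (j + 1)
  rw [div_mul_eq_mul_div, le_div_iff₀ hs]
  have h1 : rootBatch n (j + 1) / (4 * L) * G (j + 1) ≤ A j + batchNoise n L σ (j + 1) := by
    linarith
  rw [div_mul_eq_mul_div, div_le_iff₀ (by positivity)] at h1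
  linarith

/-- The one-epoch contraction under the Polyak–Łojasiewicz condition. -/
lemma contraction (R : GapRecursion n L σ A G) (hPL : ∀ j, 2 * μ * A j ≤ G j) (j : ℕ) :
    (1 + rootBatch n (j + 1) * μ / (2 * L)) * A (j + 1) ≤ A j + batchNoise n L σ (j + 1) := by
  have hL := R.L_pos
  have h1 := mul_le_mul_of_nonneg_left (hPL (j + 1))
    (div_nonneg (rootBatch_nonneg n (j + 1)) (by linarith : 0 ≤ 4 * L))
  have h2 : rootBatch n (j + 1) / (4 * L) * (2 * μ * A (j + 1)) =
      rootBatch n (j + 1) * μ / (2 * L) * A (j + 1) := by field_simp; ring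
  linarith [R.step j]

/-- Linear convergence once the big batch is the full sample. -/
lemma pow_mul_A_le (R : GapRecursion n L σ A G) (hΔ : Δ = A 0 + σ ^ 2 / L * Real.log n)
    (hμ : 0 ≤ μ) (hPL : ∀ j, 2 * μ * A j ≤ G j) {j₀ : ℕ} (hj₀ : n ≤ j₀ ^ 2) (t : ℕ) :
    (1 + √n * μ / (2 * L)) ^ t * A (j₀ + t) ≤ Δ := by
  have hL := R.L_pos
  induction t with
  | zero => simpa using R.A_le hΔ j₀
  | succ t ih =>
    have hge : n ≤ (j₀ + t + 1) ^ 2 := hj₀.trans (Nat.pow_le_pow_left (by omega) 2)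
    have h := R.contraction hPL (j₀ + t)
    rw [batchNoise, if_neg (not_lt.2 hge), rootBatch_of_ge hge, add_zero] at h
    rw [pow_succ, mul_assoc, ← add_assoc j₀ t 1]
    exact (mul_le_mul_of_nonneg_left h (by positivity)).trans ih

/-- Linear convergence up to the variance level, once the epochs are long compared to `L / μ`. -/
lemma A_le_pow_add (R : GapRecursion n L σ A G) (hΔ : Δ = A 0 + σ ^ 2 / L * Real.log n)
    (hμ : 0 < μ) (hPL : ∀ j, 2 * μ * A j ≤ G j) {j₀ : ℕ} (hj₀ : 1 ≤ j₀)
    (hs : 8 * (L / μ) ≤ rootBatch n j₀) (t : ℕ) :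
    A (j₀ + t) ≤ Δ * (1 / 5) ^ t + 5 / 2 * (σ ^ 2 / (μ * ((j₀ + t : ℕ) : ℝ) ^ 2)) := by
  have hL := R.L_pos
  induction t with
  | zero =>
    have := R.A_le hΔ j₀
    have h2 : 0 ≤ 5 / 2 * (σ ^ 2 / (μ * ((j₀ + 0 : ℕ) : ℝ) ^ 2)) := by positivity
    simp only [add_zero, pow_zero, mul_one] at *
    linarith
  | succ t ih =>
    have h := R.contraction hPL (j₀ + t)
    rw [← add_assoc j₀ t 1]
    set i := j₀ + t with hi
    have hi1 : (1 : ℝ) ≤ i := by exact_mod_cast (by omega : 1 ≤ i)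
    set q := rootBatch n (i + 1) * μ / (2 * L) with hq
    have hs' : 8 * (L / μ) ≤ rootBatch n (i + 1) := hs.trans (rootBatch_mono n (by omega))
    have hq4 : 4 ≤ q := by
      rw [hq, le_div_iff₀ (by positivity)]
      have := mul_le_mul_of_nonneg_right hs' hμ.le
      have h2 : 8 * (L / μ) * μ = 8 * L := by field_simp
      linarith
    set u := σ ^ 2 / (μ * ((i + 1 : ℕ) : ℝ) ^ 2) with hu
    have hu0 : 0 ≤ u := by positivity
    -- With equality before the full batch is reached: there `q = (i+1)μ/(2L)`, so after division by
    -- `1 + q` the noise is of order `u = σ²/(μ(i+1)²)`.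
    have hν : batchNoise n L σ (i + 1) ≤ q * (u / 2) := by
      rw [batchNoise]
      split_ifs with hlt
      · rw [hq, rootBatch_of_le hlt.le, hu]
        apply le_of_eq
        field_simp
        norm_num
      · positivity
    have hprev : σ ^ 2 / (μ * (i : ℝ) ^ 2) ≤ 4 * u := by
      rw [hu, mul_div_assoc', div_le_div_iff₀ (by positivity) (by positivity)]
      push_cast
      have : ((i : ℝ) + 1) ^ 2 ≤ 4 * (i : ℝ) ^ 2 := by nlinarith
      have h3 : 0 ≤ σ ^ 2 * μ := by positivity
      nlinarith [mul_le_mul_of_nonneg_left this h3]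
    have hΔ0 : 0 ≤ Δ := (R.A_nonneg 0).trans (R.A_le hΔ 0)
    set p : ℝ := Δ * (1 / 5) ^ t with hp
    have hp0 : 0 ≤ p := by positivity
    have h5 : (1 + q) * A (i + 1) ≤ p + 10 * u + q * (u / 2) := by linarith
    -- For `q ≥ 4` one has `1 + q ≥ 5`, the factor `1/5`, and `10 + q/2 ≤ (5/2)(1 + q)`, so the
    -- constant `5/2` reproduces itself.
    have hgoal : (1 + q) * A (i + 1) ≤ (1 + q) * (p * (1 / 5) + 5 / 2 * u) := by
      nlinarith [mul_nonneg (sub_nonneg.2 hq4) hp0, mul_nonneg (sub_nonneg.2 hq4) hu0]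
    have := le_of_mul_le_mul_left hgoal (by linarith)
    rwa [pow_succ, ← mul_assoc]

end GapRecursion

end

/-! ### Numbers of epochs that suffice, and their cost. -/

section

section LogOne

lemma one_le_logOne (x : ℝ) : 1 ≤ logOne x := le_max_right _ _

lemma le_exp_logOne (x : ℝ) : x ≤ Real.exp (logOne x) := by
  rcases le_or_gt x 0 with h | h
  · exact h.trans (Real.exp_pos _).le
  · calc x = Real.exp (Real.log x) := (Real.exp_log h).symm
      _ ≤ _ := Real.exp_le_exp.2 (le_max_left _ _)

/-- Since `logOne x ≥ 1`, a constant factor inside the logarithm costs only a constant factor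
outside it. -/
lemma two_mul_le_exp_two_mul_logOne (x : ℝ) : 2 * x ≤ Real.exp (2 * logOne x) := by
  have h1 : 2 ≤ Real.exp (logOne x) := by
    have := Real.exp_one_gt_d9
    exact (by linarith : (2 : ℝ) ≤ Real.exp 1).trans (Real.exp_le_exp.2 (one_le_logOne x))
  rw [two_mul (logOne x), Real.exp_add]
  have := le_exp_logOne x
  nlinarith [Real.exp_pos (logOne x)]

lemma four_mul_le_exp_three_mul_logOne (x : ℝ) : 4 * x ≤ Real.exp (3 * logOne x) := by
  have h1 : 2 ≤ Real.exp (logOne x) := by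
    have := Real.exp_one_gt_d9
    exact (by linarith : (2 : ℝ) ≤ Real.exp 1).trans (Real.exp_le_exp.2 (one_le_logOne x))
  have h2 := two_mul_le_exp_two_mul_logOne x
  rw [show 3 * logOne x = logOne x + 2 * logOne x by ring, Real.exp_add]
  nlinarith [Real.exp_pos (2 * logOne x)]

/-- From `log y ≤ y - 1`. It replaces `LΔ/(√n ε²)` by `μΔ/ε²` inside the logarithm, at the price of
adding `L/(μ√n)` outside. -/
lemma logOne_mul_le {x y : ℝ} (hx : 0 ≤ x) (hy : 0 < y) : logOne (y * x) ≤ logOne x + y := by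
  have h1 := one_le_logOne x
  refine max_le ?_ (by linarith)
  rcases hx.eq_or_lt with rfl | hx
  · simp; linarith
  · rw [Real.log_mul hy.ne' hx.ne']
    have h2 := Real.log_le_sub_one_of_pos hy
    have h3 : Real.log x ≤ logOne x := le_max_left _ _
    linarith

end LogOne

namespace GapRecursion

variable {n : ℕ} {L σ : ℝ} {A G : ℕ → ℝ} {Δ μ : ℝ}

lemma Δ_nonneg (R : GapRecursion n L σ A G) (hΔ : Δ = A 0 + σ ^ 2 / L * Real.log n) : 0 ≤ Δ :=
  (R.A_nonneg 0).trans (R.A_le hΔ 0)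

/-- The number of epochs after which linear convergence has set in, in the full-batch regime. -/
lemma exists_index_fullBatch (R : GapRecursion n L σ A G)
    (hΔ : Δ = A 0 + σ ^ 2 / L * Real.log n) (hμ : 0 < μ) (hPL : ∀ j, 2 * μ * A j ≤ G j) (Y : ℝ) :
    ∃ T₀ : ℕ, 1 ≤ T₀ ∧ (T₀ : ℝ) ≤ 4 * √n + 6 * logOne Y * (1 + L / μ / √n) ∧
      ∀ i, T₀ ≤ i + 1 → n ≤ i ^ 2 ∧ ∃ δ : ℝ, 0 ≤ δ ∧ 4 * Y * δ ≤ 1 ∧ A i ≤ Δ * δ := by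
  have hL := R.L_pos
  have hn : (1 : ℝ) ≤ n := by exact_mod_cast R.one_le
  have hs : 1 ≤ √(n : ℝ) := Real.one_le_sqrt.2 hn
  have hl := one_le_logOne Y
  set l := logOne Y with hl_def
  set q := √(n : ℝ) * μ / (2 * L) with hq
  have hq0 : 0 < q := by positivity
  have hqi : 1 + 1 / q = 1 + 2 * (L / μ / √n) := by rw [hq]; field_simp
  set k := L / μ / √(n : ℝ) with hk
  have hk0 : 0 < k := by positivity
  -- `⌈√n⌉` epochs reach the full batch. Then `log (1 + q) ≥ q/(1 + q)`, the inverse of `1 + 2k`, so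
  -- the second term makes `(1 + q)^t ≥ e^{3l} ≥ 4Y`. The last `1` is for gradients, where epoch `i
  -- + 1` is controlled by the gap at `i`.
  refine ⟨⌈√(n : ℝ)⌉₊ + ⌈3 * l * (1 + 2 * k)⌉₊ + 1, by omega, ?_, fun i hi => ?_⟩
  · have h1 := (Nat.ceil_lt_add_one (Real.sqrt_nonneg (n : ℝ))).le
    have h2 := (Nat.ceil_lt_add_one (by positivity : 0 ≤ 3 * l * (1 + 2 * k))).le
    push_cast
    nlinarith
  · obtain ⟨t, rfl⟩ := Nat.exists_eq_add_of_le
      (by omega : ⌈√(n : ℝ)⌉₊ ≤ i)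
    have hj₀ : n ≤ ⌈√(n : ℝ)⌉₊ ^ 2 := by
      have := Real.sqrt_le_iff.1 (Nat.le_ceil (√(n : ℝ)))
      exact_mod_cast this.2
    have ht : 3 * l * (1 + 2 * k) ≤ t :=
      (Nat.le_ceil _).trans (by exact_mod_cast (by omega : ⌈3 * l * (1 + 2 * k)⌉₊ ≤ t))
    have hlog : q / (1 + q) ≤ Real.log (1 + q) := by
      have := Real.one_sub_inv_le_log_of_pos (by positivity : 0 < 1 + q)
      refine le_trans (le_of_eq ?_) this
      field_simp
      ring
    have hpow : 4 * Y ≤ (1 + q) ^ t := by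
      refine (four_mul_le_exp_three_mul_logOne Y).trans ?_
      rw [← Real.exp_log (by positivity : 0 < (1 + q) ^ t), Real.log_pow, Real.exp_le_exp]
      calc 3 * logOne Y = 3 * l * (1 + 2 * k) * (q / (1 + q)) := by
            rw [← hl_def, ← hqi]; field_simp; ring
        _ ≤ t * Real.log (1 + q) := by gcongr
    have hpos : 0 < (1 + q) ^ t := by positivity
    refine ⟨hj₀.trans (Nat.pow_le_pow_left (by omega) 2), ((1 + q) ^ t)⁻¹, by positivity, ?_, ?_⟩
    · rw [← div_eq_mul_inv]
      exact (div_le_one hpos).2 hpow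
    · rw [← div_eq_mul_inv, le_div_iff₀ hpos, mul_comm]
      exact R.pow_mul_A_le hΔ hμ.le hPL hj₀ t

/-- The number of epochs after which the gap is at the variance level `σ² / (μ j²)`, in the regime
`L / μ ≲ √n`. -/
lemma exists_index_adaptive (R : GapRecursion n L σ A G)
    (hΔ : Δ = A 0 + σ ^ 2 / L * Real.log n) (hμ : 0 < μ) (hPL : ∀ j, 2 * μ * A j ≤ G j)
    (hκ : 8 * (L / μ) ≤ √n) (Y : ℝ) {τ : ℝ} (hτ : 0 ≤ τ) :
    ∃ T₀ : ℕ, 1 ≤ T₀ ∧ (T₀ : ℝ) ≤ 8 * (L / μ) + 6 * logOne Y + 5 * τ ∧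
      ∀ i, T₀ ≤ i + 1 → 5 * τ ≤ ((i + 1 : ℕ) : ℝ) ∧ 8 * (L / μ) ≤ rootBatch n (i + 1) ∧
        ∃ δ : ℝ, 0 ≤ δ ∧ 2 * Y * δ ≤ 1 ∧
          A i ≤ Δ * δ + 10 * (σ ^ 2 / (μ * ((i + 1 : ℕ) : ℝ) ^ 2)) := by
  have hL := R.L_pos
  have hl := one_le_logOne Y
  set l := logOne Y with hl_def
  set κ := L / μ with hκ_def
  have hκ0 : 0 < κ := by positivity
  set j₀ := ⌈8 * κ⌉₊ with hj₀
  have hj₀1 : 1 ≤ j₀ := Nat.ceil_pos.2 (by positivity)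
  -- `rootBatch` saturates at `√n`, so this needs `hκ`.
  have hroot : 8 * κ ≤ rootBatch n j₀ := by
    rw [rootBatch_eq_min]
    exact le_min (Nat.le_ceil _) hκ
  -- The terms serve in turn to make the epochs long compared to `L/μ`, to get `5^t ≥ e^{2l} ≥ 2Y`,
  -- to bring the variance level down to `1/25` of the target, and to shift from `i + 1` to `i`.
  refine ⟨j₀ + ⌈2 * l⌉₊ + ⌈5 * τ⌉₊ + 1, by omega, ?_, fun i hi => ?_⟩
  · have h1 := (Nat.ceil_lt_add_one (by positivity : 0 ≤ 8 * κ)).le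
    have h2 := (Nat.ceil_lt_add_one (by positivity : 0 ≤ 2 * l)).le
    have h3 := (Nat.ceil_lt_add_one (by positivity : 0 ≤ 5 * τ)).le
    push_cast
    linarith
  · obtain ⟨t, rfl⟩ := Nat.exists_eq_add_of_le (by omega : j₀ ≤ i)
    have ht : 2 * l ≤ t := (Nat.le_ceil _).trans (by exact_mod_cast (by omega : ⌈2 * l⌉₊ ≤ t))
    refine ⟨(Nat.le_ceil _).trans (by exact_mod_cast (by omega : ⌈5 * τ⌉₊ ≤ j₀ + t + 1)),
      hroot.trans (rootBatch_mono n (by omega)), (1 / 5) ^ t, by positivity, ?_, ?_⟩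
    · have h1 : 2 * Y ≤ 5 ^ t := by
        refine (two_mul_le_exp_two_mul_logOne Y).trans ((Real.exp_le_exp.2 ht).trans ?_)
        rw [← mul_one (t : ℝ), Real.exp_nat_mul]
        have := Real.exp_one_lt_d9
        exact pow_le_pow_left₀ (Real.exp_pos _).le (by linarith) _
      rw [one_div, inv_pow, ← div_eq_mul_inv]
      exact (div_le_one (by positivity)).2 h1
    · refine (R.A_le_pow_add hΔ hμ hPL hj₀1 hroot t).trans ?_
      have hi1 : (1 : ℝ) ≤ ((j₀ + t : ℕ) : ℝ) := by exact_mod_cast (by omega : 1 ≤ j₀ + t)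
      rw [Nat.cast_add _ 1, Nat.cast_one]
      set x : ℝ := ((j₀ + t : ℕ) : ℝ) with hx
      have : σ ^ 2 / (μ * x ^ 2) ≤ 4 * (σ ^ 2 / (μ * (x + 1) ^ 2)) := by
        rw [mul_div_assoc', div_le_div_iff₀ (by positivity) (by positivity)]
        have h3 : 0 ≤ σ ^ 2 * μ := by positivity
        have h4 : (x + 1) ^ 2 ≤ 4 * x ^ 2 := by nlinarith
        nlinarith [mul_le_mul_of_nonneg_left h4 h3]
      linarith

lemma exists_index_G_fullBatch (R : GapRecursion n L σ A G)
    (hΔ : Δ = A 0 + σ ^ 2 / L * Real.log n) (hμ : 0 < μ) (hPL : ∀ j, 2 * μ * A j ≤ G j)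
    {ε : ℝ} (hε : 0 < ε) :
    ∃ T₀ : ℕ, 1 ≤ T₀ ∧
      (T₀ : ℝ) ≤ 4 * √n + 6 * logOne (L * Δ / (√n * ε ^ 2)) * (1 + L / μ / √n) ∧
      ∀ j ≥ T₀, G j ≤ ε ^ 2 := by
  have hL := R.L_pos
  have hn : (1 : ℝ) ≤ n := by exact_mod_cast R.one_le
  have hs : 0 < √(n : ℝ) := by positivity
  obtain ⟨T₀, h1, h2, h3⟩ := R.exists_index_fullBatch hΔ hμ hPL (L * Δ / (√n * ε ^ 2))
  refine ⟨T₀, h1, h2, fun j hj => ?_⟩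
  obtain ⟨i, rfl⟩ := Nat.exists_eq_add_of_le' (h1.trans hj)
  obtain ⟨hi, δ, _, hYδ, hAi⟩ := h3 i hj
  have hge : n ≤ (i + 1) ^ 2 := hi.trans (Nat.pow_le_pow_left (by omega) 2)
  have hG := R.G_succ_le i
  rw [batchNoise, if_neg (not_lt.2 hge), rootBatch_of_ge hge, add_zero] at hG
  calc G (i + 1) ≤ 4 * L / √n * A i := hG
    _ ≤ 4 * L / √n * (Δ * δ) := by gcongr
    _ = 4 * (L * Δ / (√n * ε ^ 2)) * δ * ε ^ 2 := by field_simp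
    _ ≤ 1 * ε ^ 2 := by gcongr
    _ = ε ^ 2 := one_mul _

lemma exists_index_A_fullBatch (R : GapRecursion n L σ A G)
    (hΔ : Δ = A 0 + σ ^ 2 / L * Real.log n) (hμ : 0 < μ) (hPL : ∀ j, 2 * μ * A j ≤ G j)
    {ε : ℝ} (hε : 0 < ε) :
    ∃ T₀ : ℕ, 1 ≤ T₀ ∧
      (T₀ : ℝ) ≤ 4 * √n + 6 * logOne (Δ / ε ^ 2) * (1 + L / μ / √n) ∧
      ∀ j ≥ T₀, A j ≤ ε ^ 2 := by
  have hΔ0 := R.Δ_nonneg hΔ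
  obtain ⟨T₀, h1, h2, h3⟩ := R.exists_index_fullBatch hΔ hμ hPL (Δ / ε ^ 2)
  refine ⟨T₀, h1, h2, fun j hj => ?_⟩
  obtain ⟨_, δ, hδ, hYδ, hAi⟩ := h3 j (by omega)
  have h4 : 4 * (Δ * δ) = 4 * (Δ / ε ^ 2) * δ * ε ^ 2 := by field_simp
  have h5 := mul_le_mul_of_nonneg_right hYδ (sq_nonneg ε)
  nlinarith [mul_nonneg hΔ0 hδ]

lemma exists_index_G_adaptive (R : GapRecursion n L σ A G)
    (hΔ : Δ = A 0 + σ ^ 2 / L * Real.log n) (hμ : 0 < μ) (hPL : ∀ j, 2 * μ * A j ≤ G j)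
    (hκ : 8 * (L / μ) ≤ √n) (hσ : 0 ≤ σ) {ε : ℝ} (hε : 0 < ε) :
    ∃ T₀ : ℕ, 1 ≤ T₀ ∧
      (T₀ : ℝ) ≤ 8 * (L / μ) + 6 * logOne (μ * Δ / ε ^ 2) + 5 * (σ / ε) ∧
      ∀ j ≥ T₀, G j ≤ ε ^ 2 := by
  have hL := R.L_pos
  obtain ⟨T₀, h1, h2, h3⟩ := R.exists_index_adaptive hΔ hμ hPL hκ (μ * Δ / ε ^ 2)
    (by positivity : 0 ≤ σ / ε)
  refine ⟨T₀, h1, h2, fun j hj => ?_⟩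
  obtain ⟨i, rfl⟩ := Nat.exists_eq_add_of_le' (h1.trans hj)
  obtain ⟨hτ, hroot, δ, hδ, hYδ, hAi⟩ := h3 i hj
  have hG := R.G_succ_le i
  have hs := R.rootBatch_pos i
  set s := rootBatch n (i + 1) with hs_def
  set x : ℝ := ((i + 1 : ℕ) : ℝ) with hx
  have hx0 : 0 < x := by rw [hx]; positivity
  have hcoef : 4 * L / s ≤ μ / 2 := by
    rw [div_le_div_iff₀ hs (by norm_num)]
    have := mul_le_mul_of_nonneg_right hroot hμ.le
    have h4 : 8 * (L / μ) * μ = 8 * L := by field_simp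
    linarith
  have hnoise : 4 * L / s * batchNoise n L σ (i + 1) ≤ σ ^ 2 / x ^ 2 := by
    rw [batchNoise]
    split_ifs with hlt
    · rw [hs_def, rootBatch_of_le hlt.le, hx]
      apply le_of_eq
      field_simp
    · rw [mul_zero]; positivity
  have hvar : σ ^ 2 / x ^ 2 ≤ ε ^ 2 / 25 := by
    rw [div_le_div_iff₀ (by positivity) (by norm_num)]
    have h4 : 5 * σ ≤ x * ε := by
      have := mul_le_mul_of_nonneg_right hτ hε.le
      rwa [mul_assoc, div_mul_cancel₀ _ hε.ne'] at this
    nlinarith [mul_nonneg hx0.le hε.le]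
  have hA1 : 4 * L / s * A i ≤ μ / 2 * (Δ * δ + 10 * (σ ^ 2 / (μ * x ^ 2))) :=
    mul_le_mul hcoef hAi (R.A_nonneg i) (by positivity)
  have h4 : μ / 2 * (Δ * δ + 10 * (σ ^ 2 / (μ * x ^ 2))) =
      (2 * (μ * Δ / ε ^ 2) * δ) * ε ^ 2 / 4 + 5 * (σ ^ 2 / x ^ 2) := by
    field_simp
    ring
  have h5 := mul_le_mul_of_nonneg_right hYδ (sq_nonneg ε)
  rw [mul_add] at hG
  -- The shares of `ε²` are `1/4` (initial gap), `5/25` (variance in the gap) and `1/25` (noise of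
  -- the last epoch).
  nlinarith [sq_nonneg ε]

lemma exists_index_A_adaptive (R : GapRecursion n L σ A G)
    (hΔ : Δ = A 0 + σ ^ 2 / L * Real.log n) (hμ : 0 < μ) (hPL : ∀ j, 2 * μ * A j ≤ G j)
    (hκ : 8 * (L / μ) ≤ √n) (hσ : 0 ≤ σ) {ε : ℝ} (hε : 0 < ε) :
    ∃ T₀ : ℕ, 1 ≤ T₀ ∧
      (T₀ : ℝ) ≤ 8 * (L / μ) + 6 * logOne (Δ / ε ^ 2) + 5 * (σ / (√μ * ε)) ∧
      ∀ j ≥ T₀, A j ≤ ε ^ 2 := by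
  have hsμ : 0 < √μ := Real.sqrt_pos.2 hμ
  obtain ⟨T₀, h1, h2, h3⟩ := R.exists_index_adaptive hΔ hμ hPL hκ (Δ / ε ^ 2)
    (by positivity : 0 ≤ σ / (√μ * ε))
  refine ⟨T₀, h1, h2, fun j hj => ?_⟩
  obtain ⟨hτ, _, δ, hδ, hYδ, hAi⟩ := h3 j (by omega)
  set x : ℝ := ((j + 1 : ℕ) : ℝ) with hx
  have hx0 : 0 < x := by rw [hx]; positivity
  have hvar : σ ^ 2 / (μ * x ^ 2) ≤ ε ^ 2 / 25 := by
    rw [div_le_div_iff₀ (by positivity) (by norm_num)]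
    have h4 : 5 * σ ≤ x * (√μ * ε) := by
      have := mul_le_mul_of_nonneg_right hτ (by positivity : 0 ≤ √μ * ε)
      rwa [mul_assoc, div_mul_cancel₀ _ (by positivity)] at this
    have h5 := pow_le_pow_left₀ (by positivity) h4 2
    rw [mul_pow, mul_pow, mul_pow, Real.sq_sqrt hμ.le] at h5
    linarith
  have h4 : 2 * (Δ * δ) = 2 * (Δ / ε ^ 2) * δ * ε ^ 2 := by field_simp
  have h5 := mul_le_mul_of_nonneg_right hYδ (sq_nonneg ε)
  nlinarith [sq_nonneg ε]

/-- The number of epochs after which the output is stationary, for a general objective. -/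
lemma exists_index_general (R : GapRecursion n L σ A G)
    (hΔ : Δ = A 0 + σ ^ 2 / L * Real.log n) {ε : ℝ} (hε : 0 < ε) :
    ∃ T₀ : ℕ, 1 ≤ T₀ ∧
      (∀ T : ℕ, T₀ ≤ T → 4 * L * Δ ≤ ε ^ 2 * ((T : ℝ) * rootBatch n T)) ∧
      (min (24 * (T₀ : ℝ) ^ 3) (6 * n * T₀) : ℝ) ≤ 1536 *
        min (max ((L * Δ) ^ (3 / 2 : ℝ) / ε ^ 3) 1) (max (√n * L * Δ / ε ^ 2) 1) := by
  have hL := R.L_pos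
  have hΔ0 := R.Δ_nonneg hΔ
  have hn : (1 : ℝ) ≤ n := by exact_mod_cast R.one_le
  set r := √(n : ℝ) with hr
  have hr1 : 1 ≤ r := Real.one_le_sqrt.2 hn
  have hr2 : r ^ 2 = n := Real.sq_sqrt (by linarith)
  set p := √(L * Δ) / ε with hp
  have hp0 : 0 ≤ p := by positivity
  have hp2 : p ^ 2 = L * Δ / ε ^ 2 := by rw [hp, div_pow, Real.sq_sqrt (by positivity)]
  have h3 : (L * Δ) ^ (3 / 2 : ℝ) / ε ^ 3 = p ^ 3 := by
    rw [hp, div_pow, Real.sqrt_eq_rpow, ← Real.rpow_natCast ((L * Δ) ^ (1 / 2 : ℝ)),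
      ← Real.rpow_mul (by positivity)]
    norm_num
  have h4 : r * L * Δ / ε ^ 2 = r * p ^ 2 := by rw [hp2]; ring
  rw [h3, h4]
  -- The requirement is `T min(T, √n) ≥ 4p²`, with one entry of the maximum for each branch of the
  -- minimum.
  set M := max (max (2 * p) (4 * p ^ 2 / r)) 1 with hM
  have hM1 : 1 ≤ M := le_max_right _ _
  have hMp : 2 * p ≤ M := (le_max_left _ _).trans (le_max_left _ _)
  have hMr : 4 * p ^ 2 / r ≤ M := (le_max_right _ _).trans (le_max_left _ _)
  have hT := Nat.le_ceil M
  have hT2 : (⌈M⌉₊ : ℝ) ≤ 2 * M := by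
    have := (Nat.ceil_lt_add_one (by linarith : 0 ≤ M)).le
    linarith
  refine ⟨⌈M⌉₊, Nat.ceil_pos.2 (by linarith), fun T hTT => ?_, ?_⟩
  · have hTM : M ≤ T := hT.trans (by exact_mod_cast hTT)
    have hT0 : (0 : ℝ) ≤ T := Nat.cast_nonneg _
    have h5 : 4 * L * Δ = ε ^ 2 * (4 * p ^ 2) := by rw [hp2]; field_simp
    rw [h5, rootBatch_eq_min]
    refine mul_le_mul_of_nonneg_left ?_ (sq_nonneg ε)
    rw [mul_min_of_nonneg _ _ hT0]
    refine le_min ?_ ?_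
    · nlinarith
    · rw [← div_le_iff₀ (by linarith)]
      exact hMr.trans hTM
  · set N : ℝ := (⌈M⌉₊ : ℝ) with hN
    have hN0 : 0 ≤ N := Nat.cast_nonneg _
    have hp3 : 0 ≤ p ^ 3 := by positivity
    -- If `2p ≤ √n`, the run is over by about the time the batch is full and the cubic cost is used;
    -- otherwise the cost `6nT`. In each case the other target is the larger one up to constants.
    rcases le_total (2 * p) r with h | h
    · have h6 : M ≤ max (2 * p) 1 := by
        refine max_le (max_le (le_max_left _ _) ((?_ : _ ≤ 2 * p).trans (le_max_left _ _)))
          (le_max_right _ _)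
        rw [div_le_iff₀ (by linarith)]
        nlinarith
      have h7 : M ^ 3 ≤ 8 * min (max (p ^ 3) 1) (max (r * p ^ 2) 1) := by
        refine (pow_le_pow_left₀ (by linarith) h6 3).trans ?_
        rw [mul_min_of_nonneg _ _ (by norm_num)]
        rcases le_total (2 * p) 1 with h8 | h8
        · rw [max_eq_right h8]
          refine le_min ?_ ?_ <;> linarith [le_max_right (p ^ 3) 1, le_max_right (r * p ^ 2) 1]
        · rw [max_eq_left h8]
          refine le_min ?_ ?_
          · nlinarith [le_max_left (p ^ 3) 1]
          · nlinarith [le_max_left (r * p ^ 2) 1, mul_le_mul_of_nonneg_right h (sq_nonneg p)]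
      have h8 := pow_le_pow_left₀ hN0 hT2 3
      refine (min_le_left _ _).trans ?_
      nlinarith
    · have h6 : M = 4 * p ^ 2 / r := by
        have h7 : 2 * p ≤ 4 * p ^ 2 / r := by
          rw [le_div_iff₀ (by linarith)]
          nlinarith
        rw [hM, max_eq_right h7, max_eq_left (by linarith)]
      have h7 : 6 * n * N ≤ 48 * (r * p ^ 2) := by
        calc 6 * n * N ≤ 6 * n * (2 * M) := by gcongr
          _ = 48 * (r * p ^ 2) := by rw [h6, ← hr2]; field_simp; ring
      refine (min_le_right _ _).trans (h7.trans ?_)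
      rw [mul_min_of_nonneg _ _ (by norm_num)]
      refine le_min ?_ ?_
      · nlinarith [le_max_left (p ^ 3) 1, mul_le_mul_of_nonneg_right h (sq_nonneg p)]
      · have : 0 ≤ r * p ^ 2 := by positivity
        nlinarith [le_max_left (r * p ^ 2) 1]

end GapRecursion

section Cost

variable {n : ℕ} {κ l : ℝ}

lemma cost_fullBatch_le (hn : 1 ≤ n) {T₀ : ℝ} {L μ : ℝ}
    (hT : T₀ ≤ 4 * √n + 6 * l * (1 + L / μ / √n)) :
    min (24 * T₀ ^ 3) (6 * n * T₀) ≤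
      36 * ((n : ℝ) ^ (3 / 2 : ℝ) + (n + √n * L / μ) * l) := by
  have hn' : (1 : ℝ) ≤ n := by exact_mod_cast hn
  set r := √(n : ℝ) with hr
  have hr1 : 1 ≤ r := Real.one_le_sqrt.2 hn'
  have hr2 : (n : ℝ) = r ^ 2 := (Real.sq_sqrt (by linarith)).symm
  have h3 : (n : ℝ) ^ (3 / 2 : ℝ) = r ^ 3 := by
    rw [hr, Real.sqrt_eq_rpow, ← Real.rpow_natCast ((n : ℝ) ^ (1 / 2 : ℝ)),
      ← Real.rpow_mul (by positivity)]
    norm_num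
  rw [h3]
  refine (min_le_right _ _).trans ?_
  calc 6 * n * T₀ ≤ 6 * n * (4 * r + 6 * l * (1 + L / μ / r)) := by gcongr
    _ = 24 * r ^ 3 + 36 * ((n + r * L / μ) * l) := by
      rw [hr2]; field_simp; ring
    _ ≤ _ := by nlinarith [pow_pos (by linarith : 0 < r) 3]

lemma cost_adaptive_le {T₀ τ : ℝ} (hT0 : 0 ≤ T₀) (hκ : 0 ≤ κ) (hl : 0 ≤ l) (hτ : 0 ≤ τ)
    (hT : T₀ ≤ 8 * κ + 6 * l + 5 * τ) :
    min (24 * T₀ ^ 3) (6 * n * T₀) ≤ 164616 * (κ ^ 3 + τ ^ 3 + l ^ 3) := by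
  refine (min_le_left _ _).trans ?_
  set m := max κ (max l τ) with hm
  have h1 : κ ≤ m := le_max_left _ _
  have h2 : l ≤ m := (le_max_left _ _).trans (le_max_right _ _)
  have h3 : τ ≤ m := (le_max_right _ _).trans (le_max_right _ _)
  -- `19 = 8 + 6 + 5`, and `24 · 19³ = 164616`.
  have h4 : T₀ ^ 3 ≤ (19 * m) ^ 3 := pow_le_pow_left₀ hT0 (by linarith) 3
  have h5 : m ^ 3 ≤ κ ^ 3 + τ ^ 3 + l ^ 3 := by
    have := pow_nonneg hκ 3
    have := pow_nonneg hl 3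
    have := pow_nonneg hτ 3
    rcases max_choice κ (max l τ) with h | h
    · rw [hm, h]; linarith
    · rw [hm, h]
      rcases max_choice l τ with h | h <;> rw [h] <;> linarith
  rw [mul_pow] at h4
  linarith

lemma sq_mul_le_cube_add_cube {a c : ℝ} (ha : 0 ≤ a) (hc : 0 ≤ c) :
    a ^ 2 * c ≤ a ^ 3 + c ^ 3 := by
  rcases le_total a c with h | h
  · nlinarith [pow_nonneg ha 3, mul_le_mul_of_nonneg_right (pow_le_pow_left₀ ha h 2) hc]
  · nlinarith [pow_nonneg hc 3, mul_le_mul_of_nonneg_left h (sq_nonneg a)]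

/-- If `√n ≲ L / μ`, the full-batch bound is dominated by the adaptive one. -/
lemma fullBatch_le_adaptive (hn : 1 ≤ n) {L μ : ℝ} (hL : 0 < L) (hμ : 0 < μ)
    (hκ : √n ≤ 8 * (L / μ)) {l l' : ℝ} (hl : 0 ≤ l) (hl' : l' ≤ l + L / μ / √n) :
    (n : ℝ) ^ (3 / 2 : ℝ) + (n + √n * L / μ) * l' ≤ 656 * (L ^ 3 / μ ^ 3 + l ^ 3) := by
  have hn' : (1 : ℝ) ≤ n := by exact_mod_cast hn
  set r := √(n : ℝ) with hr
  have hr1 : 1 ≤ r := Real.one_le_sqrt.2 hn'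
  have hr2 : (n : ℝ) = r ^ 2 := (Real.sq_sqrt (by linarith)).symm
  have h3 : (n : ℝ) ^ (3 / 2 : ℝ) = r ^ 3 := by
    rw [hr, Real.sqrt_eq_rpow, ← Real.rpow_natCast ((n : ℝ) ^ (1 / 2 : ℝ)),
      ← Real.rpow_mul (by positivity)]
    norm_num
  rw [h3, ← div_pow, mul_div_assoc, hr2]
  set κ := L / μ with hκ_def
  have hκ0 : 0 < κ := by positivity
  have h4 : (r ^ 2 + r * κ) * l' ≤ (r ^ 2 + r * κ) * (l + κ / r) := by gcongr
  have h5 : (r ^ 2 + r * κ) * (l + κ / r) = r ^ 2 * l + r * κ * l + r * κ + κ ^ 2 := by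
    field_simp
    ring
  have h6 : r ^ 3 ≤ (8 * κ) ^ 3 := pow_le_pow_left₀ (by linarith) hκ 3
  have h7 : r ^ 2 ≤ (8 * κ) ^ 2 := pow_le_pow_left₀ (by linarith) hκ 2
  have h8 := sq_mul_le_cube_add_cube hκ0.le hl
  have h9 : κ ^ 2 ≤ 8 * κ ^ 3 := by nlinarith [sq_nonneg κ]
  have h10 : r * κ ≤ 8 * κ ^ 2 := by nlinarith
  nlinarith [mul_le_mul_of_nonneg_right h7 hl, mul_le_mul_of_nonneg_right h10 hl,
    pow_nonneg hl 3]

end Cost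

end

/-! ### From epoch counts to the complexity bounds. -/

section

variable {d n : ℕ} {f : Fin n → EuclideanSpace ℝ (Fin d) → ℝ}
  {x₀ xstar : EuclideanSpace ℝ (Fin d)} {L σ μ : ℝ} {b : ℕ → ℕ} {w : ℕ → ℝ} {ε Δ : ℝ}

/-- If every iterate from epoch `T₀` on is accurate, so is the output, whatever the weights. -/
lemma complexityOf_le_of_forall_index (hb : AdmissibleBatch n b)
    {g : EuclideanSpace ℝ (Fin d) → ℝ≥0∞} {c : ℝ≥0∞} {T₀ : ℕ} (hT₀ : 1 ≤ T₀)
    (h : ∀ j ≥ T₀, expect (run (qGeomSarahWith n L b w) f x₀ j) (fun t => g t.1) ≤ c) :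
    complexityOf (qGeomSarahWith n L b w) f x₀ {T | 1 ≤ T ∧ ∀ T' ≥ T,
        expect (output (qGeomSarahWith n L b w) f x₀ T') g ≤ c} ≤
      ENNReal.ofReal (min (24 * (T₀ : ℝ) ^ 3) (6 * n * T₀)) := by
  refine complexityOf_le hb ⟨hT₀, fun T hT => ?_⟩
  rw [expect_output]
  exact expect_outputIndex_le T (fun j hj => h j (le_trans hT hj)) _

lemma gap_le_of_pl (hPL : ∀ x, 2 * μ * (objective f x - objective f xstar) ≤
      ‖gradient (objective f) x‖ ^ 2) (hμ : 0 ≤ μ) {A G : ℕ → ℝ} (hG0 : ∀ j, 0 ≤ G j)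
    (hA : ∀ j, expect (run (qGeomSarahWith n L b w) f x₀ j) (fun t => gap f xstar t.1) =
      ENNReal.ofReal (A j))
    (hG : ∀ j, expect (run (qGeomSarahWith n L b w) f x₀ j) (fun t => gradSq f t.1) =
      ENNReal.ofReal (G j)) (j : ℕ) : 2 * μ * A j ≤ G j := by
  rw [← ENNReal.ofReal_le_ofReal_iff (hG0 j), ENNReal.ofReal_mul (by positivity), ← hA, ← hG,
    ← expect_const_mul]
  refine expect_mono fun t => ?_
  rw [gap, gradSq, ← ENNReal.ofReal_mul (by positivity)]
  exact ENNReal.ofReal_le_ofReal (hPL t.1)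

/-- The complexity bounds under the Polyak–Łojasiewicz condition, for any output weights. -/
theorem comp_le_of_pl (H : IsSmoothSum f xstar L σ) (hσ : 0 ≤ σ) (hμ : 0 < μ) (hε : 0 < ε)
    (hPL : ∀ x, 2 * μ * (objective f x - objective f xstar) ≤ ‖gradient (objective f) x‖ ^ 2)
    (hb : AdmissibleBatch n b)
    (hΔ : Δ = objective f x₀ - objective f xstar + σ ^ 2 / L * Real.log n) (w : ℕ → ℝ) :
    compG (qGeomSarahWith n L b w) f x₀ ε ≤ ENNReal.ofReal (200000 *
      min (L ^ 3 / μ ^ 3 + σ ^ 3 / ε ^ 3 + logOne (μ * Δ / ε ^ 2) ^ 3)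
        ((n : ℝ) ^ (3 / 2 : ℝ) + (n + √n * L / μ) * logOne (L * Δ / (√n * ε ^ 2)))) ∧
    compF (qGeomSarahWith n L b w) f x₀ xstar ε ≤ ENNReal.ofReal (200000 *
      min (L ^ 3 / μ ^ 3 + σ ^ 3 / (μ ^ (3 / 2 : ℝ) * ε ^ 3) + logOne (Δ / ε ^ 2) ^ 3)
        ((n : ℝ) ^ (3 / 2 : ℝ) + (n + √n * L / μ) * logOne (Δ / ε ^ 2))) := by
  obtain ⟨A, G, R, hA0, hA, hG⟩ := exists_gapRecursion H hb w x₀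
  have hPL' := gap_le_of_pl hPL hμ.le R.G_nonneg hA hG
  rw [← hA0] at hΔ
  have hΔ0 := R.Δ_nonneg hΔ
  have hn := H.one_le
  have hL := H.L_pos
  have hn' : (1 : ℝ) ≤ n := by exact_mod_cast hn
  have hr1 : 1 ≤ √(n : ℝ) := Real.one_le_sqrt.2 hn'
  have compG_le : ∀ T₀ : ℕ, 1 ≤ T₀ → (∀ j ≥ T₀, G j ≤ ε ^ 2) → ∀ {c : ℝ},
      (min (24 * (T₀ : ℝ) ^ 3) (6 * n * T₀) : ℝ) ≤ c →
      compG (qGeomSarahWith n L b w) f x₀ ε ≤ ENNReal.ofReal c := fun T₀ h1 h2 c h3 =>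
    (complexityOf_le_of_forall_index hb h1 fun j hj =>
      (hG j).le.trans (ENNReal.ofReal_le_ofReal (h2 j hj))).trans (ENNReal.ofReal_le_ofReal h3)
  have compF_le : ∀ T₀ : ℕ, 1 ≤ T₀ → (∀ j ≥ T₀, A j ≤ ε ^ 2) → ∀ {c : ℝ},
      (min (24 * (T₀ : ℝ) ^ 3) (6 * n * T₀) : ℝ) ≤ c →
      compF (qGeomSarahWith n L b w) f x₀ xstar ε ≤ ENNReal.ofReal c := fun T₀ h1 h2 c h3 =>
    (complexityOf_le_of_forall_index hb h1 fun j hj =>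
      (hA j).le.trans (ENNReal.ofReal_le_ofReal (h2 j hj))).trans (ENNReal.ofReal_le_ofReal h3)
  have hscale : ∀ {c u : ℝ}, 0 ≤ u → c ≤ 200000 → c * u ≤ 200000 * u := fun hu hc =>
    mul_le_mul_of_nonneg_right hc hu
  have hσμ : σ ^ 3 / (μ ^ (3 / 2 : ℝ) * ε ^ 3) = (σ / (√μ * ε)) ^ 3 := by
    rw [div_pow, mul_pow, Real.sqrt_eq_rpow, ← Real.rpow_natCast (μ ^ (1 / 2 : ℝ)),
      ← Real.rpow_mul hμ.le]
    norm_num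
  have hfull : ∀ x, 0 ≤ (n : ℝ) ^ (3 / 2 : ℝ) + (n + √n * L / μ) * logOne x := fun x => by
    have := one_le_logOne x
    positivity
  have hcube : ∀ x, 0 ≤ logOne x ^ 3 := fun x => by
    have := one_le_logOne x
    positivity
  rw [hσμ]
  constructor
  · set l := logOne (μ * Δ / ε ^ 2) with hl_def
    have hl : 1 ≤ l := one_le_logOne _
    obtain ⟨T₁, h1, h2, h3⟩ := R.exists_index_G_fullBatch hΔ hμ hPL' hε
    have hcost := cost_fullBatch_le hn h2
    rw [min_def]
    split_ifs with hle
    -- The adaptive bound is the smaller one here. Its own index exists only when the batches can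
    -- grow to `8L/μ`; otherwise the full-batch index already meets it.
    · rcases le_total (8 * (L / μ)) (√(n : ℝ)) with hκ | hκ
      · obtain ⟨T₀, h4, h5, h6⟩ := R.exists_index_G_adaptive hΔ hμ hPL' hκ hσ hε
        refine compG_le T₀ h4 h6 ((cost_adaptive_le (Nat.cast_nonneg _) (by positivity)
          (by linarith) (by positivity) h5).trans ?_)
        rw [div_pow, div_pow]
        exact hscale (by positivity) (by norm_num)
      · refine compG_le T₁ h1 h3 (hcost.trans ?_)
        have hY : L * Δ / (√n * ε ^ 2) = L / μ / √n * (μ * Δ / ε ^ 2) := by field_simp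
        have h7 := fullBatch_le_adaptive hn hL hμ hκ (by linarith : 0 ≤ l)
          (hY ▸ logOne_mul_le (by positivity) (by positivity))
        have h8 : 0 ≤ L ^ 3 / μ ^ 3 := by positivity
        have h9 : 0 ≤ σ ^ 3 / ε ^ 3 := by positivity
        have h10 : 0 ≤ l ^ 3 := by positivity
        linarith
    · exact compG_le T₁ h1 h3 (hcost.trans (hscale (hfull _) (by norm_num)))
  · set l := logOne (Δ / ε ^ 2) with hl_def
    have hl : 1 ≤ l := one_le_logOne _
    obtain ⟨T₁, h1, h2, h3⟩ := R.exists_index_A_fullBatch hΔ hμ hPL' hε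
    have hcost := cost_fullBatch_le hn h2
    rw [min_def]
    split_ifs with hle
    · rcases le_total (8 * (L / μ)) (√(n : ℝ)) with hκ | hκ
      · obtain ⟨T₀, h4, h5, h6⟩ := R.exists_index_A_adaptive hΔ hμ hPL' hκ hσ hε
        refine compF_le T₀ h4 h6 ((cost_adaptive_le (Nat.cast_nonneg _) (by positivity)
          (by linarith) (by positivity) h5).trans ?_)
        rw [div_pow L μ]
        exact hscale (by positivity) (by norm_num)
      · refine compF_le T₁ h1 h3 (hcost.trans ?_)
        have h7 := fullBatch_le_adaptive hn hL hμ hκ (by linarith : 0 ≤ l)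
          (by linarith [(by positivity : 0 ≤ L / μ / √n)] : l ≤ l + L / μ / √n)
        have h8 : 0 ≤ L ^ 3 / μ ^ 3 := by positivity
        have h9 : 0 ≤ (σ / (√μ * ε)) ^ 3 := by positivity
        have h10 : 0 ≤ l ^ 3 := by positivity
        linarith
    · exact compF_le T₁ h1 h3 (hcost.trans (hscale (hfull _) (by norm_num)))

/-- The complexity bound for general objectives. -/
theorem compG_le_general (H : IsSmoothSum f xstar L σ) (hε : 0 < ε) (hb : AdmissibleBatch n b)
    (hΔ : Δ = objective f x₀ - objective f xstar + σ ^ 2 / L * Real.log n) :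
    compG (qGeomSarah n L b) f x₀ ε ≤ ENNReal.ofReal (200000 *
      min (max ((L * Δ) ^ (3 / 2 : ℝ) / ε ^ 3) 1) (max (√n * L * Δ / ε ^ 2) 1)) := by
  have hL := H.L_pos
  obtain ⟨A, G, R, hA0, -, hG⟩ := exists_gapRecursion H hb (qGeomSarah n L b).w x₀
  change ∀ j, expect (run (qGeomSarah n L b) f x₀ j) _ = _ at hG
  rw [← hA0] at hΔ
  obtain ⟨T₀, h1, h2, h3⟩ := R.exists_index_general hΔ hε
  -- These weights are, up to a constant, the coefficients of `G j` in the telescoped recursion, so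
  -- `b` plays no role in the law of the output index.
  have hw : ∀ j, 1 ≤ j → (qGeomSarah n L b).w j = rootBatch n j / (2 * L) := by
    intro j hj
    have hbj : (0 : ℝ) < b j := by exact_mod_cast (hb j hj).1
    have hs : 0 < rootBatch n j := by linarith [one_le_rootBatch H.one_le hj]
    change b j / (2 * L * rootBatch n j) * ((min (j ^ 2) n : ℕ) : ℝ) / b j = _
    rw [← rootBatch_sq]
    field_simp
  have hw0 : ∀ j, 0 ≤ (qGeomSarah n L b).w j := by
    intro j
    change 0 ≤ b j / (2 * L * √((min (j ^ 2) n : ℕ) : ℝ)) * ((min (j ^ 2) n : ℕ) : ℝ) / b j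
    positivity
  have hle : compG (qGeomSarah n L b) f x₀ ε ≤
      ENNReal.ofReal (min (24 * (T₀ : ℝ) ^ 3) (6 * n * T₀)) := by
    refine complexityOf_le (w := (qGeomSarah n L b).w) hb ⟨h1, fun T hT => ?_⟩
    have hT1 : 1 ≤ T := le_trans h1 hT
    have hnum : numEpochs (qGeomSarah n L b) T = 2 * T :=
      numEpochs_qGeomSarahWith (w := (qGeomSarah n L b).w) T
    rw [expect_output]
    have hcongr : (fun j => expect (run (qGeomSarah n L b) f x₀ j)
        fun t => ENNReal.ofReal (‖gradient (objective f) t.1‖ ^ 2)) =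
        fun j => ENNReal.ofReal (G j) := funext hG
    rw [hcongr]
    refine expect_outputIndex_le_of_sum_le (by omega) ?_ hw0 R.G_nonneg (sq_nonneg ε) ?_
    · rw [hw T hT1]
      have := one_le_rootBatch H.one_le hT1
      positivity
    · have h4 := R.sum_Icc_le_mul_sum hΔ (sq_nonneg ε) hT1 (h2 T hT)
      rw [hnum, Finset.sum_congr rfl fun j hj => by
          rw [hw j (hT1.trans (Finset.mem_Icc.1 hj).1)],
        Finset.sum_congr rfl fun j hj => hw j (hT1.trans (Finset.mem_Icc.1 hj).1)]
      exact h4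
  refine hle.trans (ENNReal.ofReal_le_ofReal (h3.trans ?_))
  refine mul_le_mul_of_nonneg_right (by norm_num) (le_min ?_ ?_) <;>
    exact zero_le_one.trans (le_max_right _ _)

end

end GeomSarah

end

theorem theorem2 :
    ∃ C : ℝ, 0 < C ∧
      ∀ (d n : ℕ) (f : Fin n → EuclideanSpace ℝ (Fin d) → ℝ)
        (x₀ xstar : EuclideanSpace ℝ (Fin d)) (L σ μ : ℝ) (b : ℕ → ℕ) (ε Δ : ℝ),
        1 ≤ n → 0 < L → 0 ≤ σ → 0 ≤ μ → 0 < ε →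
        (∀ i, Differentiable ℝ (f i)) →
        -- mean-square Lipschitz continuity of the stochastic gradient
        (∀ x y, (∑ i, ‖gradient (f i) x - gradient (f i) y‖ ^ 2) / n ≤ L ^ 2 * ‖x - y‖ ^ 2) →
        -- bounded variance of the stochastic gradient
        (∀ x, (∑ i, ‖gradient (f i) x - gradient (GeomSarah.objective f) x‖ ^ 2) / n ≤ σ ^ 2) →
        -- `xstar` is a minimizer, and the PL condition holds with constant `μ`, possibly zero
        (∀ x, GeomSarah.objective f xstar ≤ GeomSarah.objective f x) →
        (∀ x, 2 * μ * (GeomSarah.objective f x - GeomSarah.objective f xstar) ≤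
          ‖gradient (GeomSarah.objective f) x‖ ^ 2) →
        -- admissible mini-batch sizes
        (∀ j, 1 ≤ j → 1 ≤ b j ∧ (b j : ℝ) ≤ √((min (j ^ 2) n : ℕ) : ℝ)) →
        Δ = GeomSarah.objective f x₀ - GeomSarah.objective f xstar + σ ^ 2 / L * Real.log n →
        -- gradient norm, general objectives
        GeomSarah.compG (GeomSarah.qGeomSarah n L b) f x₀ ε ≤ ENNReal.ofReal (C *
          min (max ((L * Δ) ^ (3 / 2 : ℝ) / ε ^ 3) 1) (max (√n * L * Δ / ε ^ 2) 1)) ∧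
        -- the terms that involve `1 / μ` are infinite for `μ = 0`
        (0 < μ →
          ∀ P ∈ ({GeomSarah.qGeomSarah n L b, GeomSarah.qGeomSarah' n L b} :
              Set GeomSarah.Params),
            GeomSarah.compG P f x₀ ε ≤ ENNReal.ofReal (C *
              min (L ^ 3 / μ ^ 3 + σ ^ 3 / ε ^ 3 + GeomSarah.logOne (μ * Δ / ε ^ 2) ^ 3)
                ((n : ℝ) ^ (3 / 2 : ℝ) +
                  (n + √n * L / μ) * GeomSarah.logOne (L * Δ / (√n * ε ^ 2)))) ∧
            GeomSarah.compF P f x₀ xstar ε ≤ ENNReal.ofReal (C *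
              min (L ^ 3 / μ ^ 3 + σ ^ 3 / (μ ^ (3 / 2 : ℝ) * ε ^ 3) +
                  GeomSarah.logOne (Δ / ε ^ 2) ^ 3)
                ((n : ℝ) ^ (3 / 2 : ℝ) +
                  (n + √n * L / μ) * GeomSarah.logOne (Δ / ε ^ 2)))) := by
  refine ⟨200000, by norm_num, ?_⟩
  intro d n f x₀ xstar L σ μ b ε Δ hn hL hσ _ hε hf hlip hvar hmin hPL hb hΔ
  have H : GeomSarah.IsSmoothSum f xstar L σ := ⟨hn, hL, hf, hlip, hvar, hmin⟩
  refine ⟨GeomSarah.compG_le_general H hε hb hΔ, fun hμ P hP => ?_⟩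
  -- Both algorithms are `qGeomSarahWith` with their own weights, by definition, and the bounds
  -- under PL hold for any weights.
  rcases hP with rfl | hP
  · exact GeomSarah.comp_le_of_pl H hσ hμ hε hPL hb hΔ (GeomSarah.qGeomSarah n L b).w
  · rw [Set.mem_singleton_iff.1 hP]
    exact GeomSarah.comp_le_of_pl H hσ hμ hε hPL hb hΔ (GeomSarah.qGeomSarah' n L b).w
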